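/- Let $n\ge 1$. For $\mathbf z=\mathbf x+i\mathbf y\in\mathbb C^n$ and $\mathbf t=(t_1,\dots,t_n)\in\mathbb R^n$ with all $t_i\ge 0$, put $t=t_1+\dots+t_n$ and $$u_{\mathbf z}=\begin{pmatrix}1&0&\mathbf x^{T}\\0&1&\mathbf y^{T}\\0&0&I_n\end{pmatrix},\qquad g_{\mathbf t}=\operatorname{diag}\bigl(e^{\frac{n-1}{2n}t},e^{\frac{n-1}{2n}t},e^{-t_1},\dots,e^{-t_n}\bigr),$$ and let $\Lambda=\{(p,0,\mathbf q)^T : p\in\mathbb Z,\ \mathbf q\in\mathbb Z^n\}\subset\mathbb R^{n+2}$. For a discrete subgroup $\Gamma$ of the Euclidean space $\mathbb R^{n+2}$ let $\|\Gamma\|$ be its covolume, that is, the volume of $\mathbb R\Gamma/\Gamma$ with respect to the induced Euclidean structure on the real span $\mathbb R\Gamma$. For $C,\alpha>0$, a function $\varphi:V\to\mathbb R$ on $V\subset\mathbb C$ is called $(C,\alpha)$-good on $V$ if for every open ball $B\subset V$ of positive radius and every $\varepsilon>0$ $$\bigl|\{z\in B : |\varphi(z)|<\varepsilon\,\sup_{B}|\varphi|\}\bigr|\le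 C\varepsilon^{\alpha}|B|,$$ where $|\cdot|$ of a set is Lebesgue measure. Let $U\subset\mathbb C$ be open and let $\mathbf f=(f_1,\dots,f_n):U\to\mathbb C^n$ be complex analytic. Then: (a) for every $z_0\in U$ there exist an open ball $\tilde B\subset U$ centered at $z_0$ and constants $C,\alpha>0$ such that for all $\mathbf t\in\mathbb R^n$ with all $t_i\ge0$ and all nonzero subgroups $\Gamma$ of $\Lambda$ the function $z\mapsto\|g_{\mathbf t}u_{\mathbf f(z)}\Gamma\|$ is $(C,\alpha)$-good on $\tilde B$; (b) if, in addition, $U$ is connected and the functions $1,f_1,\dots,f_n$ on $U$ are linearly independent over $\mathbb R$, then for every open ball $B\subset U$ of positive radius there exists $\rho>0$ such that $$\sup_{z\in B}\|g_{\mathbf t}u_{\mathbf f(z)}\Gamma\|\ge\rho$$ for all $\mathbf t\in\mathbb R^n$ with all $t_i\ge0$ and all nonzero subgroups $\Gamma$ of $\Lambda$ (the supremum may be $+\infty$). -/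

import Mathlib

namespace CovolumeGood

open MeasureTheory

/-- A real-valued function `f` is `(C, α)`-good on `V`: for every ball `B ⊆ V` and every `ε > 0`,
`|{x ∈ B : |f x| < ε * sup_B |f|}| ≤ C * ε ^ α * |B|`. The supremum is taken in `[0, ∞]`. -/
def IsGood {X : Type*} [PseudoMetricSpace X] [MeasureSpace X]
    (C α : ℝ) (f : X → ℝ) (V : Set X) : Prop :=
  ∀ (c : X) (r : ℝ), 0 < r → Metric.ball c r ⊆ V → ∀ ε : ℝ, 0 < ε →
    volume {x ∈ Metric.ball c r |
        ENNReal.ofReal |f x| <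
          ENNReal.ofReal ε * ⨆ y ∈ Metric.ball c r, ENNReal.ofReal |f y|}
      ≤ ENNReal.ofReal (C * ε ^ α) * volume (Metric.ball c r)

/-- The Euclidean space `ℝ^{n+2}`. The coordinates `Sum.inl 0`, `Sum.inl 1`, `Sum.inr i` are, in
this order, the first one, the second one, and the last `n`. -/
abbrev Space (n : ℕ) : Type := EuclideanSpace ℝ (Fin 2 ⊕ Fin n)

/-- The matrix `u_z`, with rows `(1, 0, x)`, `(0, 1, y)`, `(0, 0, I_n)`, where `z = x + iy`. -/
def uMat {n : ℕ} (z : Fin n → ℂ) : Matrix (Fin 2 ⊕ Fin n) (Fin 2 ⊕ Fin n) ℝ :=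
  Matrix.fromBlocks 1 (Matrix.of ![fun i => (z i).re, fun i => (z i).im]) 0 1

/-- The matrix `g_t = diag(e^{(n-1)t/(2n)}, e^{(n-1)t/(2n)}, e^{-t_1}, …, e^{-t_n})`, where
`t = t_1 + ⋯ + t_n`. -/
noncomputable def gMat {n : ℕ} (t : Fin n → ℝ) : Matrix (Fin 2 ⊕ Fin n) (Fin 2 ⊕ Fin n) ℝ :=
  Matrix.diagonal (Sum.elim
    (fun _ => Real.exp (((n : ℝ) - 1) / (2 * (n : ℝ)) * ∑ i, t i))
    (fun i => Real.exp (-(t i))))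

/-- The group `Λ` of all column vectors `(p, 0, q)` with `p ∈ ℤ` and `q ∈ ℤ^n`. -/
def Lam (n : ℕ) : AddSubgroup (Space n) where
  carrier := {v | ∃ (p : ℤ) (q : Fin n → ℤ),
    v = WithLp.toLp 2 (Sum.elim ![(p : ℝ), 0] (fun i => (q i : ℝ)))}
  zero_mem' := ⟨0, 0, by ext (i | i) <;> (try fin_cases i) <;> simp⟩
  add_mem' := by
    rintro _ _ ⟨p, q, rfl⟩ ⟨p', q', rfl⟩
    exact ⟨p + p', q + q', by ext (i | i) <;> (try fin_cases i) <;> simp⟩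
  neg_mem' := by
    rintro _ ⟨p, q, rfl⟩
    exact ⟨-p, -q, by ext (i | i) <;> (try fin_cases i) <;> simp⟩

/-- The covolume `‖Γ‖` of a discrete subgroup `Γ` of a Euclidean space: the volume of `ℝΓ / Γ`,
where `ℝΓ` is the real span of `Γ` with the Lebesgue measure of its induced Euclidean structure. -/
noncomputable def covol {E : Type*} [NormedAddCommGroup E] [InnerProductSpace ℝ E]
    [FiniteDimensional ℝ E] [MeasurableSpace E] [BorelSpace E] (Γ : AddSubgroup E) : ℝ :=
  ZLattice.covolume
    ((AddSubgroup.toIntSubmodule Γ).comap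
      ((Submodule.span ℝ (Γ : Set E)).subtype.restrictScalars ℤ))
    (volume : Measure (Submodule.span ℝ (Γ : Set E)))

/-- The covolume `‖g_t u_z Γ‖` of the image of `Γ` under the linear map `g_t u_z`. -/
noncomputable def flowCovol {n : ℕ} (t : Fin n → ℝ) (z : Fin n → ℂ)
    (Γ : AddSubgroup (Space n)) : ℝ :=
  covol (Γ.map (Matrix.toEuclideanLin (gMat t * uMat z)).toAddMonoidHom)

/-- The functions `1, f_1, …, f_n` on `U` are linearly independent over `ℝ`. -/
def IndepWithOne {n : ℕ} (U : Set ℂ) (f : ℂ → Fin n → ℂ) : Prop :=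
  LinearIndependent ℝ
    (Fin.cons (fun _ => 1) (fun i z => f z i) : Fin (n + 1) → (U → ℂ))

end CovolumeGood

open MeasureTheory

namespace CovolumeGood

/-! ### One-variable sublevel sets through divided differences -/

section

/-! A nonzero subgroup of `Λ` has a basis that is independent over `ℝ`. With the basis as columns of
an integer matrix `V`, the squared covolume is the Gram determinant of `gMat t * uMat (f z) * V`.
Both assertions are read off from this determinant.

For (a), every entry of that product lies in the span of `1`, `Re f_i`, `Im f_i`, so the squared
covolume lies in one fixed power of this span, whatever `t` and `Γ` are
(`det_gram_mem_coordSpan_pow`). It remains to see that a finite-dimensional space of real analytic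
functions is uniformly good near each point (`exists_uniform_isGood`). By homogeneity and
compactness of the unit sphere this is local in the coefficients. A nonzero analytic function is
nonzero along the segments from the centre in two independent directions, so in each of them some
iterated derivative is nonzero at the centre; the derivative stays bounded above and away from zero
for nearby points and coefficients. Then `volume_sublevel_le` controls sublevel sets on lines, and
Fubini on a parallelogram (`volume_sublevel_prod_le`) gives goodness on balls.

For (b), write `L v = p + ∑ q_i f_i` for the vector `v = (p, 0, q)`. In rank one the covolume
dominates `|L v|`, because the first two diagonal entries of `g_t` are at least `1`. In higher rank
a Gram determinant dominates the square of each maximal minor. One uses the first two rows together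
with contracted rows that omit the largest `t_i`: then the total weight of the flow is at least `1`
(`one_le_weight`), and after a column change by an integer matrix of nonzero determinant the minor
dominates `Im (conj (L v) * L w)` for a pair `v`, `w` in a compact set of independent pairs
(`exists_minor_flow_ge`). If this expression vanished on a ball, `L w / L v` would be holomorphic
and real, hence constant, against the independence of `1, f_1, …, f_n` over `ℝ`. Compactness makes
the lower bound uniform. -/

/-- Between `m + 1` zeros of a function there are `m` zeros of its derivative. -/
theorem exists_finset_zeros_deriv {f f' : ℝ → ℝ} {a b : ℝ}
    (hf : ∀ x ∈ Set.Icc a b, HasDerivAt f (f' x) x) {m : ℕ} {s : Finset ℝ} (hs : s.card = m + 1)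
    (hsI : ∀ x ∈ s, x ∈ Set.Icc a b) (h0 : ∀ x ∈ s, f x = 0) :
    ∃ t : Finset ℝ, t.card = m ∧ (∀ x ∈ t, x ∈ Set.Icc a b) ∧ ∀ x ∈ t, f' x = 0 := by
  classical
  set e := s.orderEmbOfFin hs
  have he : ∀ i, e i ∈ s := fun i => s.orderEmbOfFin_mem hs i
  have key : ∀ i : Fin m, ∃ c, c ∈ Set.Ioo (e i.castSucc) (e i.succ) ∧ f' c = 0 := by
    intro i
    have hlt : e i.castSucc < e i.succ := e.strictMono i.castSucc_lt_succ
    have hsub : Set.Icc (e i.castSucc) (e i.succ) ⊆ Set.Icc a b :=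
      Set.Icc_subset_Icc (hsI _ (he _)).1 (hsI _ (he _)).2
    refine exists_hasDerivAt_eq_zero (f := f) hlt ?_ ?_ ?_
    · exact fun x hx => (hf x (hsub hx)).continuousAt.continuousWithinAt
    · rw [h0 _ (he _), h0 _ (he _)]
    · exact fun x hx => hf x (hsub (Set.Ioo_subset_Icc_self hx))
  choose c hc hc0 using key
  have hmono : StrictMono c := by
    intro i j hij
    have h1 : e i.succ ≤ e j.castSucc := e.monotone (Fin.succ_le_castSucc_iff.mpr hij)
    exact (hc i).2.trans_le (h1.trans (hc j).1.le)
  refine ⟨Finset.univ.image c, ?_, ?_, ?_⟩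
  · rw [Finset.card_image_of_injective _ hmono.injective]; simp
  · intro x hx
    obtain ⟨i, -, rfl⟩ := Finset.mem_image.mp hx
    exact ⟨(hsI _ (he i.castSucc)).1.trans (hc i).1.le, (hc i).2.le.trans (hsI _ (he i.succ)).2⟩
  · intro x hx
    obtain ⟨i, -, rfl⟩ := Finset.mem_image.mp hx
    exact hc0 i

/-- Iterated Rolle: if `G 0` has `ℓ + 1` zeros then its `ℓ`-th derivative `G ℓ` has a zero. -/
theorem exists_zero_iterated_deriv {a b : ℝ} (ℓ : ℕ) :
    ∀ (G : ℕ → ℝ → ℝ), (∀ k < ℓ, ∀ x ∈ Set.Icc a b, HasDerivAt (G k) (G (k + 1) x) x) →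
    ∀ s : Finset ℝ, s.card = ℓ + 1 → (∀ x ∈ s, x ∈ Set.Icc a b) → (∀ x ∈ s, G 0 x = 0) →
    ∃ ξ ∈ Set.Icc a b, G ℓ ξ = 0 := by
  induction ℓ with
  | zero =>
    intro G _ s hs hsI h0
    obtain ⟨x, hx⟩ := Finset.card_pos.mp (by omega : 0 < s.card)
    exact ⟨x, hsI x hx, h0 x hx⟩
  | succ ℓ ih =>
    intro G hG s hs hsI h0
    obtain ⟨t, ht, htI, ht0⟩ := exists_finset_zeros_deriv (hG 0 (by omega)) hs hsI h0
    exact ih (fun k => G (k + 1)) (fun k hk => hG (k + 1) (by omega)) t ht htI ht0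

/-- The mean value theorem for divided differences. -/
theorem exists_iterated_deriv_eq_divided_difference {a b : ℝ} {ℓ : ℕ} {G : ℕ → ℝ → ℝ}
    (hG : ∀ k < ℓ, ∀ x ∈ Set.Icc a b, HasDerivAt (G k) (G (k + 1) x) x)
    {s : Finset ℝ} (hs : s.card = ℓ + 1) (hsI : ∀ x ∈ s, x ∈ Set.Icc a b) :
    ∃ ξ ∈ Set.Icc a b, G ℓ ξ = (ℓ.factorial : ℝ) * ∑ x ∈ s, G 0 x / ∏ y ∈ s.erase x, (x - y) := by
  classical
  set P := Lagrange.interpolate s id (G 0) with hP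
  have hinj : Set.InjOn (id : ℝ → ℝ) s := Set.injOn_id _
  have hdeg : P.degree < s.card := Lagrange.degree_interpolate_lt _ hinj
  have hnat : P.natDegree ≤ ℓ := by
    have := Lagrange.degree_interpolate_le (G 0) hinj
    rw [hs, Nat.add_sub_cancel] at this
    exact Polynomial.natDegree_le_of_degree_le this
  have heval : ∀ x ∈ s, P.eval x = G 0 x := fun x hx =>
    Lagrange.eval_interpolate_at_node (G 0) hinj hx
  -- Subtracting the Lagrange interpolant creates `ℓ + 1` zeros. The `ℓ`-th derivative of the
  -- interpolant is the constant `ℓ!` times its top coefficient, which is the divided difference.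
  obtain ⟨ξ, hξ, h⟩ := exists_zero_iterated_deriv ℓ
    (fun k x => G k x - (Polynomial.derivative^[k] P).eval x)
    (fun k hk x hx => by
      have h1 := (Polynomial.derivative^[k] P).hasDerivAt x
      rw [← Function.iterate_succ_apply' Polynomial.derivative k P] at h1
      exact (hG k hk x hx).sub h1) s hs hsI
    (fun x hx => by simp [heval x hx])
  refine ⟨ξ, hξ, ?_⟩
  have hc := Lagrange.coeff_eq_sum hinj hdeg
  have h2 : (Polynomial.derivative^[ℓ] P).natDegree = 0 := by
    have := Polynomial.natDegree_iterate_derivative P ℓ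
    omega
  have h3 : (Polynomial.derivative^[ℓ] P).eval ξ = (ℓ.factorial : ℝ) * P.coeff ℓ := by
    rw [Polynomial.eq_C_of_natDegree_eq_zero h2, Polynomial.eval_C,
      Polynomial.coeff_iterate_derivative]
    simp [Nat.descFactorial_self]
  have h4 : G ℓ ξ = (Polynomial.derivative^[ℓ] P).eval ξ := by linarith
  rw [h4, h3]
  congr 1
  rw [hs] at hc
  simp only [Nat.add_sub_cancel, id] at hc
  rw [hc]
  exact Finset.sum_congr rfl fun x hx => by rw [heval x hx]

/-- A set of measure larger than `2 d k` contains `k + 1` points with mutual distances at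
least `d`. -/
theorem exists_separated_finset {E : Set ℝ} {d : ℝ} (hd : 0 < d) (k : ℕ)
    (hE : ENNReal.ofReal (2 * d * k) < volume E) :
    ∃ s : Finset ℝ, s.card = k + 1 ∧ (∀ x ∈ s, x ∈ E) ∧
      ∀ x ∈ s, ∀ y ∈ s, x ≠ y → d ≤ |x - y| := by
  classical
  induction k with
  | zero =>
    obtain ⟨x, hx⟩ := nonempty_of_measure_ne_zero (by simpa using hE.ne_bot : volume E ≠ 0)
    exact ⟨{x}, by simp, by simpa using hx, by
      intro y hy z hz hyz
      simp only [Finset.mem_singleton] at hy hz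
      exact absurd (hy.trans hz.symm) hyz⟩
  | succ k ih =>
    obtain ⟨s, hs, hsE, hsd⟩ := ih (lt_of_le_of_lt (ENNReal.ofReal_le_ofReal (by
      push_cast; nlinarith)) hE)
    -- Greedy choice: the balls of radius `d` about the `k + 1` points found so far are too small to
    -- cover `E`.
    have hU : volume (⋃ x ∈ s, Metric.ball x d) ≤ ENNReal.ofReal (2 * d * (k + 1 : ℕ)) := by
      refine (measure_biUnion_finset_le s _).trans ?_
      simp only [Real.volume_ball, Finset.sum_const, hs]
      rw [← ENNReal.ofReal_nsmul]
      refine ENNReal.ofReal_le_ofReal ?_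
      simp [mul_comm]
    have : ¬ E ⊆ ⋃ x ∈ s, Metric.ball x d := fun h =>
      absurd (hE.trans_le (measure_mono h)) (not_lt.mpr hU)
    obtain ⟨z, hzE, hz⟩ := Set.not_subset.mp this
    have hz' : ∀ x ∈ s, d ≤ |z - x| := by
      intro x hx
      by_contra hlt
      exact hz (Set.mem_biUnion hx (by simpa [Real.dist_eq] using not_le.mp hlt))
    have hzs : z ∉ s := fun h => by
      have := hz' z h
      simp at this; linarith
    refine ⟨insert z s, by rw [Finset.card_insert_of_notMem hzs, hs], ?_, ?_⟩
    · intro x hx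
      rcases Finset.mem_insert.mp hx with rfl | hx
      exacts [hzE, hsE x hx]
    · intro x hx y hy hxy
      rcases Finset.mem_insert.mp hx with hxz | hxs <;>
        rcases Finset.mem_insert.mp hy with hyz | hys
      · exact absurd (hxz.trans hyz.symm) hxy
      · exact hxz ▸ hz' y hys
      · rw [abs_sub_comm]; exact hyz ▸ hz' x hxs
      · exact hsd x hxs y hys hxy

/-- If a function whose `ℓ`-th derivative lies between `δ` and `A` in absolute value is bounded by
`η` at `ℓ + 1` points with mutual distances at least `d`, then it is bounded by a multiple of
`η ((b - a) / d) ^ ℓ` everywhere. -/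
theorem abs_le_of_separated {a b δ A η d : ℝ} {ℓ : ℕ} {G : ℕ → ℝ → ℝ} (hδ : 0 < δ) (hd : 0 < d)
    (hG : ∀ k < ℓ, ∀ x ∈ Set.Icc a b, HasDerivAt (G k) (G (k + 1) x) x)
    (hGδ : ∀ x ∈ Set.Icc a b, δ ≤ |G ℓ x|) (hGA : ∀ x ∈ Set.Icc a b, |G ℓ x| ≤ A)
    {s : Finset ℝ} (hs : s.card = ℓ + 1) (hsI : ∀ x ∈ s, x ∈ Set.Icc a b)
    (hsd : ∀ x ∈ s, ∀ y ∈ s, x ≠ y → d ≤ |x - y|) (hη : ∀ x ∈ s, |G 0 x| ≤ η)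
    {x : ℝ} (hx : x ∈ Set.Icc a b) :
    |G 0 x| ≤ (ℓ + 1) * (A / δ + 1) * η * ((b - a) / d) ^ ℓ := by
  classical
  obtain ⟨x₀, hx₀⟩ := Finset.card_pos.mp (by omega : 0 < s.card)
  have hη0 : 0 ≤ η := (abs_nonneg _).trans (hη x₀ hx₀)
  have hA : 0 < A := hδ.trans_le ((hGδ x hx).trans (hGA x hx))
  have hdiam : ∀ u ∈ Set.Icc a b, ∀ v ∈ Set.Icc a b, |u - v| ≤ b - a := fun u hu v hv =>
    abs_sub_le_of_le_of_le hu.1 hu.2 hv.1 hv.2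
  have hab : a ≤ b := hx.1.trans hx.2
  have hR0 : 0 ≤ (b - a) / d := div_nonneg (by linarith) hd.le
  -- the lower bound for the `ℓ`-th derivative
  have hlow : δ ≤ ℓ.factorial * ((ℓ + 1) * (η / d ^ ℓ)) := by
    obtain ⟨ξ, hξ, h⟩ := exists_iterated_deriv_eq_divided_difference hG hs hsI
    refine (hGδ ξ hξ).trans ?_
    rw [h, abs_mul, Nat.abs_cast]
    refine mul_le_mul_of_nonneg_left ?_ (Nat.cast_nonneg _)
    refine (Finset.abs_sum_le_sum_abs _ _).trans ?_
    have : ∀ y ∈ s, |G 0 y / ∏ z ∈ s.erase y, (y - z)| ≤ η / d ^ ℓ := by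
      intro y hy
      rw [abs_div, Finset.abs_prod]
      have hp : d ^ ℓ ≤ ∏ z ∈ s.erase y, |y - z| := by
        have : (s.erase y).card = ℓ := by rw [Finset.card_erase_of_mem hy, hs]; rfl
        rw [← this]
        rw [← Finset.prod_const]
        refine Finset.prod_le_prod (fun _ _ => hd.le) fun z hz => ?_
        exact hsd y hy z (Finset.mem_of_mem_erase hz) (Finset.ne_of_mem_erase hz).symm
      exact div_le_div₀ hη0 (hη y hy) (by positivity) hp
    refine (Finset.sum_le_card_nsmul s _ _ this).trans_eq ?_
    rw [hs, nsmul_eq_mul]; push_cast; ring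
  by_cases hxs : x ∈ s
  · have h1 : (1 : ℝ) ≤ ((b - a) / d) ^ ℓ := by
      rcases Nat.eq_zero_or_pos ℓ with rfl | hℓ
      · simp
      · obtain ⟨u, hu, v, hv, huv⟩ := Finset.one_lt_card.mp (by omega : 1 < s.card)
        refine one_le_pow₀ ?_
        rw [le_div_iff₀ hd, one_mul]
        exact (hsd u hu v hv huv).trans (hdiam u (hsI u hu) v (hsI v hv))
    have h2 : (1 : ℝ) ≤ (ℓ + 1) * (A / δ + 1) :=
      one_le_mul_of_one_le_of_one_le (by linarith [Nat.cast_nonneg (α := ℝ) ℓ])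
        (by linarith [div_pos hA hδ])
    calc |G 0 x| ≤ 1 * η * 1 := by simpa using hη x hxs
      _ ≤ _ := by gcongr
  -- Exchange the node `x₀` for `x`: the mean value theorem on the new nodes can be solved for `G 0
  -- x`, leaving only values at the old nodes and `G ℓ ξ`.
  · set s₀ := s.erase x₀ with hs₀
    have hs₀c : s₀.card = ℓ := by rw [hs₀, Finset.card_erase_of_mem hx₀, hs]; rfl
    have hs₀s : ∀ y ∈ s₀, y ∈ s := fun y hy => Finset.mem_of_mem_erase hy
    have hxs₀ : x ∉ s₀ := fun h => hxs (hs₀s x h)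
    obtain ⟨ξ, hξ, h⟩ := exists_iterated_deriv_eq_divided_difference hG
      (s := insert x s₀) (by rw [Finset.card_insert_of_notMem hxs₀, hs₀c])
      (by
        intro y hy
        rcases Finset.mem_insert.mp hy with rfl | hy
        exacts [hx, hsI y (hs₀s y hy)])
    rw [Finset.sum_insert hxs₀, Finset.erase_insert hxs₀] at h
    set Q := ∏ y ∈ s₀, (x - y) with hQ
    have hQ0 : Q ≠ 0 := Finset.prod_ne_zero_iff.mpr fun y hy =>
      sub_ne_zero.mpr fun e => hxs₀ (e ▸ hy)
    have hQle : |Q| ≤ (b - a) ^ ℓ := by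
      rw [hQ, Finset.abs_prod, ← hs₀c, ← Finset.prod_const]
      exact Finset.prod_le_prod (fun _ _ => abs_nonneg _) fun y hy =>
        hdiam x hx y (hsI y (hs₀s y hy))
    have hfac : (0 : ℝ) < ℓ.factorial := by exact_mod_cast ℓ.factorial_pos
    have hGx : G 0 x = Q * (G ℓ ξ / ℓ.factorial) -
        ∑ y ∈ s₀, Q * (G 0 y / ∏ z ∈ (insert x s₀).erase y, (y - z)) := by
      rw [h, ← Finset.mul_sum]; field_simp; ring
    have hterm : ∀ y ∈ s₀, |Q * (G 0 y / ∏ z ∈ (insert x s₀).erase y, (y - z))| ≤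
        η * ((b - a) / d) ^ ℓ := by
      intro y hy
      have hyx : y ≠ x := fun e => hxs₀ (e ▸ hy)
      have hcard : (s₀.erase y).card = ℓ - 1 := by rw [Finset.card_erase_of_mem hy, hs₀c]
      have hℓ : 1 ≤ ℓ := hs₀c ▸ Finset.card_pos.mpr ⟨y, hy⟩
      rw [Finset.erase_insert_of_ne hyx.symm,
        Finset.prod_insert (fun h => hxs₀ (Finset.mem_of_mem_erase h)), hQ,
        ← Finset.mul_prod_erase _ _ hy]
      have hne : ∏ z ∈ s₀.erase y, (y - z) ≠ 0 := Finset.prod_ne_zero_iff.mpr fun z hz =>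
        sub_ne_zero.mpr (Finset.ne_of_mem_erase hz).symm
      have e1 : (x - y) * (∏ z ∈ s₀.erase y, (x - z)) *
          (G 0 y / ((y - x) * ∏ z ∈ s₀.erase y, (y - z))) =
          -(G 0 y * ((∏ z ∈ s₀.erase y, (x - z)) / ∏ z ∈ s₀.erase y, (y - z))) := by
        have : y - x ≠ 0 := sub_ne_zero.mpr hyx
        field_simp; ring
      rw [e1, abs_neg, abs_mul, ← Finset.prod_div_distrib, Finset.abs_prod]
      refine mul_le_mul (hη y (hs₀s y hy)) ?_ (Finset.prod_nonneg fun _ _ => abs_nonneg _) hη0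
      have h1 : (1 : ℝ) ≤ (b - a) / d := by
        rw [le_div_iff₀ hd, one_mul]
        have hyx₀ : y ≠ x₀ := (Finset.ne_of_mem_erase hy)
        exact (hsd y (hs₀s y hy) x₀ hx₀ hyx₀).trans
          (hdiam y (hsI y (hs₀s y hy)) x₀ (hsI x₀ hx₀))
      calc ∏ z ∈ s₀.erase y, |(x - z) / (y - z)| ≤ ∏ z ∈ s₀.erase y, (b - a) / d := by
            refine Finset.prod_le_prod (fun _ _ => abs_nonneg _) fun z hz => ?_
            have hz' := hs₀s z (Finset.mem_of_mem_erase hz)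
            rw [abs_div]
            exact div_le_div₀ (by linarith) (hdiam x hx z (hsI z hz')) hd
              (hsd y (hs₀s y hy) z hz' (Finset.ne_of_mem_erase hz).symm)
        _ = ((b - a) / d) ^ (ℓ - 1) := by rw [Finset.prod_const, hcard]
        _ ≤ ((b - a) / d) ^ ℓ := pow_le_pow_right₀ h1 (by omega)
    -- The bound `A` carries no factor `η`. Writing `A = (A / δ) * δ` and applying `hlow` to `δ`
    -- supplies it.
    have hmain : |Q * (G ℓ ξ / ℓ.factorial)| ≤ (ℓ + 1) * (A / δ) * η * ((b - a) / d) ^ ℓ := by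
      rw [abs_mul, abs_div, Nat.abs_cast]
      have h1 : |G ℓ ξ| / ℓ.factorial ≤ A / δ * ((ℓ + 1) * (η / d ^ ℓ)) := by
        rw [div_le_iff₀ hfac]
        calc |G ℓ ξ| ≤ A := hGA ξ hξ
          _ = A / δ * δ := by field_simp
          _ ≤ A / δ * (ℓ.factorial * ((ℓ + 1) * (η / d ^ ℓ))) := by gcongr
          _ = _ := by ring
      calc |Q| * (|G ℓ ξ| / ℓ.factorial) ≤ (b - a) ^ ℓ * (A / δ * ((ℓ + 1) * (η / d ^ ℓ))) := by
            gcongr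
        _ = _ := by rw [div_pow]; ring
    rw [hGx]
    refine (abs_sub _ _).trans ?_
    refine (add_le_add hmain ((Finset.abs_sum_le_sum_abs _ _).trans
      (Finset.sum_le_card_nsmul s₀ _ _ hterm))).trans ?_
    rw [hs₀c, nsmul_eq_mul]
    have : 0 ≤ η * ((b - a) / d) ^ ℓ := by positivity
    nlinarith

/-- The constant in the sublevel estimate for functions whose `ℓ`-th derivative lies between `δ`
and `A`. -/
noncomputable def sublevelConst (ℓ : ℕ) (δ A : ℝ) : ℝ :=
  2 * (ℓ + 1) * ((ℓ + 1) * (A / δ + 1)) ^ (1 / ((ℓ : ℝ) + 1))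

theorem sublevelConst_pos {ℓ : ℕ} {δ A : ℝ} (hδ : 0 < δ) (hA : 0 < A) :
    0 < sublevelConst ℓ δ A := by
  unfold sublevelConst; positivity

/-- The sublevel estimate for functions of one variable with `ℓ`-th derivative bounded above and
away from zero. -/
theorem volume_sublevel_le {a b δ A M ε : ℝ} {ℓ : ℕ} {G : ℕ → ℝ → ℝ} (hab : a < b) (hδ : 0 < δ)
    (hG : ∀ k < ℓ, ∀ x ∈ Set.Icc a b, HasDerivAt (G k) (G (k + 1) x) x)
    (hGδ : ∀ x ∈ Set.Icc a b, δ ≤ |G ℓ x|) (hGA : ∀ x ∈ Set.Icc a b, |G ℓ x| ≤ A)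
    {x₀ : ℝ} (hx₀ : x₀ ∈ Set.Icc a b) (hM : M ≤ |G 0 x₀|) (hε : 0 < ε) :
    volume {x ∈ Set.Icc a b | |G 0 x| < ε * M} ≤
      ENNReal.ofReal (sublevelConst ℓ δ A * ε ^ (1 / ((ℓ : ℝ) + 1)) * (b - a)) := by
  set E := {x ∈ Set.Icc a b | |G 0 x| < ε * M} with hE
  have hA : 0 < A := hδ.trans_le ((hGδ x₀ hx₀).trans (hGA x₀ hx₀))
  have hEle : volume E ≤ ENNReal.ofReal (b - a) :=
    (measure_mono fun x hx => hx.1).trans_eq Real.volume_Icc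
  have hEfin : volume E ≠ ⊤ := ne_top_of_le_ne_top ENNReal.ofReal_ne_top hEle
  rw [← ENNReal.ofReal_toReal hEfin]
  refine ENNReal.ofReal_le_ofReal ?_
  set m := (volume E).toReal with hm
  have hmR : m ≤ b - a := ENNReal.toReal_le_of_le_ofReal (by linarith) hEle
  have hba : 0 < b - a := by linarith
  rcases (ENNReal.toReal_nonneg : 0 ≤ m).eq_or_lt with h0 | hmpos
  · change m ≤ _
    rw [hm, ← h0]
    have := (sublevelConst_pos (ℓ := ℓ) hδ hA).le
    positivity
  have hℓ : (0 : ℝ) < ℓ + 1 := by positivity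
  -- With this `d` one has `2 * d * ℓ < m`, as separation requires, and the denominator does not
  -- vanish for `ℓ = 0`.
  set d := m / (2 * (ℓ + 1)) with hd
  have hdpos : 0 < d := by positivity
  obtain ⟨s, hs, hsE, hsd⟩ := exists_separated_finset (E := E) hdpos ℓ (by
    rw [← ENNReal.ofReal_toReal hEfin, ENNReal.ofReal_lt_ofReal_iff hmpos]
    change 2 * d * ℓ < m
    have : m = 2 * d * (ℓ + 1) := by rw [hd]; field_simp
    nlinarith)
  have hMpos : 0 < M := by
    obtain ⟨x, hx⟩ := Finset.card_pos.mp (by omega : 0 < s.card)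
    have := (abs_nonneg _).trans_lt (hsE x hx).2
    exact pos_of_mul_pos_right this hε.le
  have hle := abs_le_of_separated hδ hdpos hG hGδ hGA hs (fun x hx => (hsE x hx).1) hsd
    (fun x hx => (hsE x hx).2.le) hx₀
  set K := ((ℓ : ℝ) + 1) * (A / δ + 1) with hK
  have hKpos : 0 < K := by positivity
  set u := d / (b - a) with hu
  have hupos : 0 < u := by positivity
  have hu1 : u ≤ 1 := by
    rw [hu, div_le_one hba, hd]
    refine (div_le_self hmpos.le ?_).trans hmR
    linarith [Nat.cast_nonneg (α := ℝ) ℓ]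
  have h1 : u ^ ℓ ≤ K * ε := by
    have h2 : M ≤ K * (ε * M) * ((b - a) / d) ^ ℓ := hM.trans hle
    have h3 : ((b - a) / d) = u⁻¹ := by rw [hu, inv_div]
    rw [h3, inv_pow] at h2
    have h4 : M * u ^ ℓ ≤ K * (ε * M) := by
      have := mul_le_mul_of_nonneg_right h2 (pow_pos hupos ℓ).le
      rwa [mul_assoc, inv_mul_cancel₀ (pow_pos hupos ℓ).ne', mul_one] at this
    have : M * u ^ ℓ ≤ M * (K * ε) := by linarith
    exact le_of_mul_le_mul_left this hMpos
  -- Since `u ≤ 1`, the power may be raised to `ℓ + 1`; the root taken next then also makes sense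
  -- for `ℓ = 0`.
  have h2 : u ^ (ℓ + 1) ≤ K * ε := (pow_le_pow_of_le_one hupos.le hu1 (by omega)).trans h1
  have h3 : u ≤ (K * ε) ^ (1 / ((ℓ : ℝ) + 1)) := by
    have := Real.rpow_le_rpow (by positivity) h2 (by positivity : 0 ≤ 1 / ((ℓ : ℝ) + 1))
    rwa [← Real.rpow_natCast, ← Real.rpow_mul hupos.le, Nat.cast_add, Nat.cast_one,
      mul_one_div_cancel hℓ.ne', Real.rpow_one] at this
  rw [Real.mul_rpow hKpos.le hε.le] at h3
  have h4 : m = 2 * (ℓ + 1) * u * (b - a) := by rw [hu, hd]; field_simp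
  rw [h4, sublevelConst]
  have : 2 * (ℓ + 1) * u ≤ 2 * (ℓ + 1) * (K ^ (1 / ((ℓ : ℝ) + 1)) * ε ^ (1 / ((ℓ : ℝ) + 1))) := by
    gcongr
  refine mul_le_mul_of_nonneg_right (this.trans_eq ?_) hba.le
  ring

end

/-! ### Sublevel sets on a rectangle -/

theorem measurableSet_sublevel {X : Type*} [TopologicalSpace X] [MeasurableSpace X]
    [OpensMeasurableSpace X] {g : X → ℝ} {K : Set X} (hK : MeasurableSet K)
    (hg : ContinuousOn g K) (m : ℝ) : MeasurableSet {x ∈ K | |g x| < m} := by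
  obtain ⟨u, hu, h⟩ := (continuousOn_iff'.mp hg.abs) (Set.Iio m) isOpen_Iio
  have : {x ∈ K | |g x| < m} = u ∩ K := by
    rw [← h]; ext x; simp [and_comm]
  rw [this]
  exact hu.measurableSet.inter hK

/-- The sublevel estimate on a rectangle, from the sublevel estimates on all horizontal and all
vertical sections. -/
theorem volume_sublevel_prod_le {F : ℝ × ℝ → ℝ} {a₁ b₁ a₂ b₂ : ℝ}
    (hF : ContinuousOn F (Set.Icc a₁ b₁ ×ˢ Set.Icc a₂ b₂)) {m₁ m₂ η M : ℝ}
    (hm₁ : 0 ≤ m₁) (hm₂ : 0 ≤ m₂) (hab₁ : a₁ ≤ b₁) (hab₂ : a₂ ≤ b₂)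
    (h₁ : ∀ y ∈ Set.Icc a₂ b₂, ∀ x₀ ∈ Set.Icc a₁ b₁, ∀ M, M ≤ |F (x₀, y)| →
      volume {x ∈ Set.Icc a₁ b₁ | |F (x, y)| < η * M} ≤ ENNReal.ofReal (m₁ * (b₁ - a₁)))
    (h₂ : ∀ x ∈ Set.Icc a₁ b₁, ∀ y₀ ∈ Set.Icc a₂ b₂, ∀ M, M ≤ |F (x, y₀)| →
      volume {y ∈ Set.Icc a₂ b₂ | |F (x, y)| < η * M} ≤ ENNReal.ofReal (m₂ * (b₂ - a₂)))
    {p₀ : ℝ × ℝ} (hp₀ : p₀ ∈ Set.Icc a₁ b₁ ×ˢ Set.Icc a₂ b₂) (hM : M ≤ |F p₀|) :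
    volume {p ∈ Set.Icc a₁ b₁ ×ˢ Set.Icc a₂ b₂ | |F p| < η ^ 2 * M} ≤
      ENNReal.ofReal ((m₁ + m₂) * ((b₁ - a₁) * (b₂ - a₂))) := by
  obtain ⟨x₀, y₀⟩ := p₀
  obtain ⟨hx₀, hy₀⟩ : x₀ ∈ Set.Icc a₁ b₁ ∧ y₀ ∈ Set.Icc a₂ b₂ := hp₀
  set E := {p ∈ Set.Icc a₁ b₁ ×ˢ Set.Icc a₂ b₂ | |F p| < η ^ 2 * M} with hE
  have hEm : MeasurableSet E :=
    measurableSet_sublevel (measurableSet_Icc.prod measurableSet_Icc) hF _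
  -- Split the columns by the value on the row through `p₀`. The columns in `S` are few; any other
  -- column contains a value of size at least `η * M`, so its own section estimate with factor `η`
  -- reaches the threshold `η ^ 2 * M`.
  set S := {x ∈ Set.Icc a₁ b₁ | |F (x, y₀)| < η * M} with hS
  have hSm : MeasurableSet S := by
    refine measurableSet_sublevel (g := fun x => F (x, y₀)) measurableSet_Icc ?_ _
    exact hF.comp (by fun_prop) fun x hx => ⟨hx, hy₀⟩
  have hSv : volume S ≤ ENNReal.ofReal (m₁ * (b₁ - a₁)) := h₁ y₀ hy₀ x₀ hx₀ M hM
  rw [Measure.volume_eq_prod, Measure.prod_apply hEm]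
  have hpt : ∀ x, volume (Prod.mk x ⁻¹' E) ≤
      S.indicator (fun _ => ENNReal.ofReal (b₂ - a₂)) x +
      (Set.Icc a₁ b₁).indicator (fun _ => ENNReal.ofReal (m₂ * (b₂ - a₂))) x := by
    intro x
    by_cases hx : x ∈ Set.Icc a₁ b₁
    · by_cases hxS : x ∈ S
      · rw [Set.indicator_of_mem hxS]
        refine le_add_right ((measure_mono fun y hy => hy.1.2).trans_eq Real.volume_Icc)
      · rw [Set.indicator_of_mem hx]
        refine le_add_left ((measure_mono ?_).trans
          (h₂ x hx y₀ hy₀ (η * M) (not_lt.mp fun h => hxS ⟨hx, h⟩)))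
        intro y hy
        refine ⟨hy.1.2, ?_⟩
        have := hy.2
        rw [← mul_assoc, ← sq]; exact this
    · have : Prod.mk x ⁻¹' E = ∅ := Set.eq_empty_of_forall_notMem fun y hy => hx hy.1.1
      rw [this]; simp
  refine (lintegral_mono hpt).trans ?_
  rw [lintegral_add_left (measurable_const.indicator hSm), lintegral_indicator hSm,
    lintegral_indicator measurableSet_Icc, lintegral_const, lintegral_const,
    Measure.restrict_apply_univ, Measure.restrict_apply_univ, Real.volume_Icc,
    ← ENNReal.ofReal_mul (by have := sub_nonneg.mpr hab₂; positivity)]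
  refine (add_le_add_left (mul_le_mul_right hSv _) _).trans ?_
  rw [← ENNReal.ofReal_mul (sub_nonneg.mpr hab₂), ← ENNReal.ofReal_add]
  · refine ENNReal.ofReal_le_ofReal (le_of_eq ?_); ring
  · have := sub_nonneg.mpr hab₁; have := sub_nonneg.mpr hab₂; positivity
  · have := sub_nonneg.mpr hab₁; have := sub_nonneg.mpr hab₂; positivity

/-! ### Goodness -/

/-- Lying strictly below a scaled supremum means lying below one scaled value. This removes the `[0,
∞]`-valued supremum, the infinite case included. -/
theorem sublevel_eq_exists {X : Type*} {f : X → ℝ} {B : Set X} {ε : ℝ} (hε : 0 < ε) :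
    {x ∈ B | ENNReal.ofReal |f x| < ENNReal.ofReal ε * ⨆ y ∈ B, ENNReal.ofReal |f y|} =
      {x ∈ B | ∃ y ∈ B, |f x| < ε * |f y|} := by
  ext x
  simp only [Set.mem_ofPred_eq, ENNReal.mul_iSup, lt_iSup_iff, ← ENNReal.ofReal_mul hε.le,
    ENNReal.ofReal_lt_ofReal_iff', exists_prop]
  refine and_congr_right fun _ => exists_congr fun y => and_congr_right fun _ =>
    and_iff_left_of_imp fun h => (abs_nonneg _).trans_lt h

section IsGood

variable {X : Type*} [PseudoMetricSpace X] [MeasureSpace X]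

theorem isGood_iff {C α : ℝ} {f : X → ℝ} {V : Set X} :
    IsGood C α f V ↔ ∀ (c : X) (r : ℝ), 0 < r → Metric.ball c r ⊆ V → ∀ ε : ℝ, 0 < ε →
      volume {x ∈ Metric.ball c r | ∃ y ∈ Metric.ball c r, |f x| < ε * |f y|} ≤
        ENNReal.ofReal (C * ε ^ α) * volume (Metric.ball c r) := by
  unfold IsGood
  refine forall₄_congr fun c r _ _ => forall₂_congr fun ε hε => ?_
  rw [sublevel_eq_exists hε]

/-- Only `ε ≤ 1` matters once the constant is at least `1`. -/
theorem isGood_of_le_one {C α : ℝ} {f : X → ℝ} {V : Set X} (hC : 1 ≤ C) (hα : 0 ≤ α)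
    (h : ∀ (c : X) (r : ℝ), 0 < r → Metric.ball c r ⊆ V → ∀ ε : ℝ, 0 < ε → ε ≤ 1 →
      volume {x ∈ Metric.ball c r | ∃ y ∈ Metric.ball c r, |f x| < ε * |f y|} ≤
        ENNReal.ofReal (C * ε ^ α) * volume (Metric.ball c r)) : IsGood C α f V := by
  rw [isGood_iff]
  intro c r hr hB ε hε
  rcases le_total ε 1 with h1 | h1
  · exact h c r hr hB ε hε h1
  · refine (measure_mono fun x hx => hx.1).trans ?_
    refine le_mul_of_one_le_left zero_le ?_
    rw [ENNReal.one_le_ofReal]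
    exact one_le_mul_of_one_le_of_one_le hC (Real.one_le_rpow h1 hα)

/-- For `ε ≤ 1` a smaller exponent gives a weaker bound, and for `ε ≥ 1` the bound is trivial
because `1 ≤ C'`. This allows constants from finitely many neighbourhoods to be merged. -/
theorem IsGood.mono {C C' α α' : ℝ} {f : X → ℝ} {V V' : Set X} (h : IsGood C α f V) (hC : C ≤ C')
    (hC' : 1 ≤ C') (hα : α' ≤ α) (hα' : 0 ≤ α') (hV : V' ⊆ V) : IsGood C' α' f V' := by
  refine isGood_of_le_one hC' hα' fun c r hr hB ε hε hε1 => ?_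
  refine ((isGood_iff.mp h) c r hr (hB.trans hV) ε hε).trans ?_
  gcongr ENNReal.ofReal ?_ * _
  exact mul_le_mul hC (Real.rpow_le_rpow_of_exponent_ge hε hε1 hα) (by positivity) (by linarith)

theorem IsGood.congr {C α : ℝ} {f g : X → ℝ} {V : Set X} (h : IsGood C α f V)
    (hfg : Set.EqOn f g V) : IsGood C α g V := by
  rw [isGood_iff] at h ⊢
  intro c r hr hB ε hε
  convert h c r hr hB ε hε using 2
  ext x
  refine and_congr_right fun hx => exists_congr fun y => and_congr_right fun hy => ?_
  rw [hfg (hB hx), hfg (hB hy)]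

theorem IsGood.smul {C α : ℝ} {f : X → ℝ} {V : Set X} (h : IsGood C α f V) {t : ℝ} (ht : t ≠ 0) :
    IsGood C α (fun x => t * f x) V := by
  rw [isGood_iff] at h ⊢
  intro c r hr hB ε hε
  convert h c r hr hB ε hε using 2
  ext x
  refine and_congr_right fun hx => exists_congr fun y => and_congr_right fun hy => ?_
  rw [abs_mul, abs_mul, mul_left_comm, mul_lt_mul_iff_right₀ (abs_pos.mpr ht)]

theorem isGood_of_eqOn_zero {C α : ℝ} {f : X → ℝ} {V : Set X} (h : Set.EqOn f 0 V) :
    IsGood C α f V := by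
  rw [isGood_iff]
  intro c r hr hB ε hε
  have : {x ∈ Metric.ball c r | ∃ y ∈ Metric.ball c r, |f x| < ε * |f y|} = ∅ := by
    refine Set.eq_empty_of_forall_notMem fun x hx => ?_
    obtain ⟨hx, y, hy, hxy⟩ := hx
    rw [h (hB hx), h (hB hy)] at hxy
    simp at hxy
  rw [this]; simp

/-- If `f ^ 2` is good, so is `f`. -/
theorem IsGood.of_sq {C α : ℝ} {f : X → ℝ} {V : Set X} (h : IsGood C α (fun x => f x ^ 2) V) :
    IsGood C (2 * α) f V := by
  rw [isGood_iff] at h ⊢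
  intro c r hr hB ε hε
  have := h c r hr hB (ε ^ 2) (by positivity)
  rw [← Real.rpow_natCast ε 2, ← Real.rpow_mul hε.le] at this
  refine le_trans (measure_mono ?_) this
  rintro x ⟨hx, y, hy, hxy⟩
  refine ⟨hx, y, hy, ?_⟩
  rw [abs_pow, abs_pow, Real.rpow_natCast, ← mul_pow]
  exact pow_lt_pow_left₀ hxy (abs_nonneg _) two_ne_zero

end IsGood

/-! ### Directional derivatives -/

/-- The derivative of `f` in the direction `v`. -/
noncomputable def dirDeriv (v : ℂ) (f : ℂ → ℝ) : ℂ → ℝ := fun z => fderiv ℝ f z v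

theorem analyticOnNhd_dirDeriv_iterate {U : Set ℂ} {f : ℂ → ℝ} (hf : AnalyticOnNhd ℝ f U) (v : ℂ)
    (k : ℕ) : AnalyticOnNhd ℝ ((dirDeriv v)^[k] f) U := by
  induction k with
  | zero => exact hf
  | succ k ih =>
    rw [Function.iterate_succ_apply']
    exact (ContinuousLinearMap.apply ℝ ℝ v).comp_analyticOnNhd ih.fderiv

theorem hasDerivAt_dirDeriv_iterate {U : Set ℂ} {f : ℂ → ℝ} (hf : AnalyticOnNhd ℝ f U) (v p : ℂ)
    (k : ℕ) {s : ℝ} (hs : p + s * v ∈ U) :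
    HasDerivAt (fun s : ℝ => (dirDeriv v)^[k] f (p + s * v))
      ((dirDeriv v)^[k + 1] f (p + s * v)) s := by
  have h1 := (analyticOnNhd_dirDeriv_iterate hf v k _ hs).differentiableAt.hasFDerivAt
  have h2 : HasDerivAt (fun s : ℝ => p + s * v) v s := by
    have := (Complex.ofRealCLM.hasDerivAt (x := s)).mul_const v
    simpa using this.const_add p
  have := h1.comp_hasDerivAt s h2
  rw [Function.iterate_succ_apply']
  exact this

/-- An analytic function of one variable all of whose derivatives vanish at a point vanishes. -/
theorem eqOn_zero_of_forall_iterated_deriv_eq_zero {W : Set ℝ} (hW : IsOpen W)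
    (hWc : IsPreconnected W) {G : ℕ → ℝ → ℝ} (hG : ∀ k, ∀ x ∈ W, HasDerivAt (G k) (G (k + 1) x) x)
    (hG0 : AnalyticOnNhd ℝ (G 0) W) {x₀ : ℝ} (hx₀ : x₀ ∈ W) (h : ∀ k, G k x₀ = 0) :
    Set.EqOn (G 0) 0 W := by
  have key : ∀ k, ∀ x ∈ W, iteratedDeriv k (G 0) x = G k x := by
    intro k
    induction k with
    | zero => intro x _; simp
    | succ k ih =>
      intro x hx
      rw [iteratedDeriv_succ]
      have : iteratedDeriv k (G 0) =ᶠ[nhds x] G k := by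
        filter_upwards [hW.mem_nhds hx] with y hy using ih y hy
      rw [this.deriv_eq, (hG k x hx).deriv]
  refine hG0.eqOn_zero_of_preconnected_of_eventuallyEq_zero hWc hx₀ ?_
  refine analyticOrderAt_eq_top.mp (ENat.eq_top_iff_forall_ge.mpr fun m => ?_)
  rw [natCast_le_analyticOrderAt_iff_iteratedDeriv_eq_zero (hG0 x₀ hx₀)]
  intro i _
  rw [key i x₀ hx₀, h i]

/-- If all derivatives of an analytic function at the centre of a ball in the direction `v` vanish,
then the function vanishes on the segment in that direction. -/
theorem eq_zero_of_forall_directional_deriv_eq_zero {z₀ v : ℂ} {r : ℝ} {G : ℕ → ℂ → ℝ}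
    (hG0 : AnalyticOnNhd ℝ (G 0) (Metric.ball z₀ r))
    (hG : ∀ k, ∀ s : ℝ, z₀ + s * v ∈ Metric.ball z₀ r →
      HasDerivAt (fun s : ℝ => G k (z₀ + s * v)) (G (k + 1) (z₀ + s * v)) s)
    (hv : z₀ + v ∈ Metric.ball z₀ r) (h : ∀ k, G k z₀ = 0) : G 0 (z₀ + v) = 0 := by
  have hr : 0 < r := dist_nonneg.trans_lt hv
  set L : ℝ →L[ℝ] ℂ := (ContinuousLinearMap.toSpanSingleton ℝ v) with hL
  have hLs : ∀ s : ℝ, L s = s * v := fun s => by simp [hL]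
  set W : Set ℝ := L ⁻¹' Metric.ball 0 r with hW
  have hmem : ∀ s ∈ W, z₀ + s * v ∈ Metric.ball z₀ r := by
    intro s hs
    have : L s ∈ Metric.ball 0 r := hs
    rw [hLs] at this
    simpa [Metric.mem_ball, dist_eq_norm] using this
  have hWc : IsPreconnected W :=
    ((convex_ball (0 : ℂ) r).linear_preimage L.toLinearMap).isPreconnected
  have h0 : (0 : ℝ) ∈ W := by simp [hW, hr]
  have h1 : (1 : ℝ) ∈ W := by
    have : L 1 ∈ Metric.ball 0 r := by
      rw [hLs]; simpa [Metric.mem_ball, dist_eq_norm] using hv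
    exact this
  have han : AnalyticOnNhd ℝ (fun s : ℝ => G 0 (z₀ + s * v)) W := by
    intro s hs
    have hg : AnalyticAt ℝ (fun s : ℝ => z₀ + (s : ℂ) * v) s := by
      have := L.analyticAt s
      simp only [hL] at this
      have h2 : (fun s : ℝ => z₀ + (s : ℂ) * v) = fun s => z₀ + L s := by
        ext s; rw [hLs]
      rw [h2]
      exact analyticAt_const.add (L.analyticAt s)
    exact AnalyticAt.fun_comp (f := fun s : ℝ => z₀ + (s : ℂ) * v) (hG0 _ (hmem s hs)) hg
  have := eqOn_zero_of_forall_iterated_deriv_eq_zero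
    (G := fun k s => G k (z₀ + s * v)) (Metric.isOpen_ball.preimage L.continuous)
    hWc (fun k x hx => hG k x (hmem x hx)) han h0
    (fun k => by simpa using h k) h1
  simpa using this

/-! ### Goodness from derivatives in two independent directions -/

/-- The linear coordinates on `ℂ` given by two directions. -/
noncomputable def planeMap (v w : ℂ) : ℝ × ℝ →ₗ[ℝ] ℂ :=
  (LinearMap.toSpanSingleton ℝ ℂ v).coprod (LinearMap.toSpanSingleton ℝ ℂ w)

theorem planeMap_apply (v w : ℂ) (p : ℝ × ℝ) : planeMap v w p = p.1 * v + p.2 * w := by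
  simp [planeMap]

/-- Lebesgue measure on `ℂ` transported by `T.symm` is a Haar measure, hence a constant multiple of
Lebesgue measure on the plane. Adding `1` to that constant makes positivity immediate. -/
theorem exists_volume_image_le (T : (ℝ × ℝ) ≃L[ℝ] ℂ) :
    ∃ K : ℝ, 0 < K ∧ ∀ S : Set (ℝ × ℝ), volume (T '' S) ≤ ENNReal.ofReal K * volume S := by
  have := T.symm.isAddHaarMeasure_map (volume : Measure ℂ)
  have h := Measure.isAddLeftInvariant_eq_smul (Measure.map T.symm (volume : Measure ℂ))
    (volume : Measure (ℝ × ℝ))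
  set k := Measure.addHaarScalarFactor (Measure.map T.symm (volume : Measure ℂ))
    (volume : Measure (ℝ × ℝ))
  refine ⟨k + 1, by positivity, fun S => ?_⟩
  have h1 : volume (T '' S) = Measure.map T.symm (volume : Measure ℂ) S := by
    have := T.symm.toHomeomorph.toMeasurableEquiv.map_apply (μ := (volume : Measure ℂ)) S
    rw [ContinuousLinearEquiv.image_eq_preimage_symm]
    exact this.symm
  rw [h1, h, Measure.smul_apply, ENNReal.smul_def, smul_eq_mul]
  gcongr
  rw [← ENNReal.ofReal_coe_nnreal]
  exact ENNReal.ofReal_le_ofReal (by linarith)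

/-- A function is good on a small ball if in each of two independent directions some directional
derivative is bounded above and away from zero; uniform version. -/
theorem isGood_of_directional_bounds (T : (ℝ × ℝ) ≃L[ℝ] ℂ) {δ A r₁ : ℝ} (hδ : 0 < δ) (hA : 0 < A)
    (hr₁ : 0 < r₁) (ℓ : Fin 2 → ℕ) :
    ∃ r C α : ℝ, 0 < r ∧ r ≤ r₁ ∧ 1 ≤ C ∧ 0 < α ∧ ∀ (z₀ : ℂ) (G : Fin 2 → ℕ → ℂ → ℝ),
      (∀ i, ∀ k, ∀ p : ℂ, ∀ s : ℝ, p + s * T (if i = 0 then (1, 0) else (0, 1)) ∈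
        Metric.ball z₀ r₁ →
        HasDerivAt (fun s : ℝ => G i k (p + s * T (if i = 0 then (1, 0) else (0, 1))))
          (G i (k + 1) (p + s * T (if i = 0 then (1, 0) else (0, 1)))) s) →
      ContinuousOn (G 0 0) (Metric.ball z₀ r₁) →
      G 0 0 = G 1 0 →
      (∀ i, ∀ z ∈ Metric.ball z₀ r₁, δ ≤ |G i (ℓ i) z| ∧ |G i (ℓ i) z| ≤ A) →
      IsGood C α (G 0 0) (Metric.ball z₀ r) := by
  obtain ⟨K, hK, hTK⟩ := exists_volume_image_le T
  obtain ⟨κ, hκ, hTκ⟩ := T.symm.toContinuousLinearMap.bound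
  obtain ⟨τ, hτ, hTτ⟩ := T.toContinuousLinearMap.bound
  set C₁ := sublevelConst (ℓ 0) δ A with hC₁
  set C₂ := sublevelConst (ℓ 1) δ A with hC₂
  have hC₁p : 0 < C₁ := sublevelConst_pos hδ hA
  have hC₂p : 0 < C₂ := sublevelConst_pos hδ hA
  set α₁ := 1 / ((ℓ 0 : ℝ) + 1) with hα₁
  set α₂ := 1 / ((ℓ 1 : ℝ) + 1) with hα₂
  have hα₁p : 0 < α₁ := by positivity
  have hα₂p : 0 < α₂ := by positivity
  -- A ball of radius `ρ` is enclosed in the image of a square of side `2 * κ * ρ`. Thus `4 * κ ^ 2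
  -- / π` compares areas, `K` is the distortion of `T`, and `C₁ + C₂` comes from the two families of
  -- sections. The exponent is halved below because the rectangle estimate is used with `η = √ε`.
  set C₀ := K * ((C₁ + C₂) * (4 * κ ^ 2)) / Real.pi with hC₀
  refine ⟨r₁ / (1 + τ * κ), max 1 C₀, min α₁ α₂ / 2, by positivity,
    div_le_self hr₁.le (by nlinarith [mul_pos hτ hκ]), le_max_left _ _, by positivity, ?_⟩
  intro z₀ G hG hcont hG01 hb
  refine isGood_of_le_one (le_max_left _ _) (by positivity) fun c ρ hρ hB ε hε hε1 => ?_
  set r := r₁ / (1 + τ * κ) with hr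
  have hrpos : 0 < r := by positivity
  have hρr : ρ ≤ r := by
    have h1 := Metric.diam_mono hB Metric.isBounded_ball
    rw [Metric.diam_ball_eq c hρ.le, Metric.diam_ball_eq z₀ hrpos.le] at h1
    linarith
  have hcz : dist c z₀ < r := hB (Metric.mem_ball_self hρ)
  set R := κ * ρ with hR
  have hRpos : 0 < R := by positivity
  set Q : Set (ℝ × ℝ) := Set.Icc (-R) R ×ˢ Set.Icc (-R) R with hQ
  have hQmem : ∀ p : ℝ × ℝ, ‖p‖ ≤ R ↔ p ∈ Q := by
    intro p
    simp only [hQ, Set.mem_prod, Set.mem_Icc, Prod.norm_def, max_le_iff, Real.norm_eq_abs, abs_le]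
  -- The radius `r₁ / (1 + τ * κ)` is chosen for this: the centre `c` is within `r` of `z₀`, and the
  -- parallelogram reaches at most `τ * κ * r` further.
  have hQin : ∀ p ∈ Q, c + T p ∈ Metric.ball z₀ r₁ := by
    intro p hp
    have h1 : ‖T p‖ ≤ τ * R := (hTτ p).trans (by gcongr; exact (hQmem p).mpr hp)
    have h2 : r * (1 + τ * κ) = r₁ := by rw [hr]; field_simp
    have h3 : τ * R ≤ τ * κ * r := by rw [hR, ← mul_assoc]; gcongr
    rw [Metric.mem_ball, dist_eq_norm] at *
    calc ‖c + T p - z₀‖ = ‖(c - z₀) + T p‖ := by ring_nf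
      _ ≤ ‖c - z₀‖ + ‖T p‖ := norm_add_le _ _
      _ < r₁ := by nlinarith
  set F : ℝ × ℝ → ℝ := fun p => G 0 0 (c + T p) with hF
  have hFc : ContinuousOn F Q :=
    hcont.comp (f := fun p => c + T p) (by fun_prop) hQin
  have hQcompact : IsCompact Q := isCompact_Icc.prod isCompact_Icc
  obtain ⟨p₀, hp₀, hmax⟩ := hQcompact.exists_isMaxOn
    ⟨(0, 0), by simp [hQ, hRpos.le]⟩ hFc.abs
  -- the sections
  have hT : ∀ x y : ℝ, T (x, y) = x * T (1, 0) + y * T (0, 1) := by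
    intro x y
    have : ((x, y) : ℝ × ℝ) = x • (1, 0) + y • (0, 1) := by simp
    rw [this, map_add, map_smul, map_smul, Complex.real_smul, Complex.real_smul]
  set η := Real.sqrt ε with hη
  have hηpos : 0 < η := Real.sqrt_pos.mpr hε
  have hη1 : η ≤ 1 := Real.sqrt_le_one.mpr hε1
  have hηsq : η ^ 2 = ε := Real.sq_sqrt hε.le
  have hmain := volume_sublevel_prod_le (η := η) (M := |F p₀|) (m₁ := C₁ * η ^ α₁)
    (m₂ := C₂ * η ^ α₂) hFc (by positivity) (by positivity)
    (by linarith) (by linarith) (by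
      intro y hy x₀ hx₀ M hM
      have e : ∀ x : ℝ, c + T (x, y) = c + y * T (0, 1) + x * T (1, 0) := by
        intro x; rw [hT]; ring
      simp only [hF, e] at hM ⊢
      have hmem : ∀ x ∈ Set.Icc (-R) R, c + y * T (0, 1) + x * T (1, 0) ∈ Metric.ball z₀ r₁ := by
        intro x hx
        rw [← e]; exact hQin _ ⟨hx, hy⟩
      exact volume_sublevel_le (ℓ := ℓ 0)
        (G := fun k x => G 0 k (c + y * T (0, 1) + x * T (1, 0))) (by linarith) hδ
        (fun k _ x hx => by simpa using hG 0 k (c + y * T (0, 1)) x (by simpa using hmem x hx))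
        (fun x hx => (hb 0 _ (hmem x hx)).1) (fun x hx => (hb 0 _ (hmem x hx)).2) hx₀ hM hηpos)
    (by
      intro x hx y₀ hy₀ M hM
      have e : ∀ y : ℝ, c + T (x, y) = c + x * T (1, 0) + y * T (0, 1) := by
        intro y; rw [hT]; ring
      simp only [hF, e, hG01] at hM ⊢
      have hmem : ∀ y ∈ Set.Icc (-R) R, c + x * T (1, 0) + y * T (0, 1) ∈ Metric.ball z₀ r₁ := by
        intro y hy
        rw [← e]; exact hQin _ ⟨hx, hy⟩
      exact volume_sublevel_le (ℓ := ℓ 1)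
        (G := fun k y => G 1 k (c + x * T (1, 0) + y * T (0, 1))) (by linarith) hδ
        (fun k _ y hy => by simpa using hG 1 k (c + x * T (1, 0)) y (by simpa using hmem y hy))
        (fun y hy => (hb 1 _ (hmem y hy)).1) (fun y hy => (hb 1 _ (hmem y hy)).2) hy₀ hM hηpos)
    hp₀ le_rfl
  rw [hηsq] at hmain
  set E := {p ∈ Q | |F p| < ε * |F p₀|} with hE
  have hpre : ∀ z ∈ Metric.ball c ρ, T.symm (z - c) ∈ Q := by
    intro z hz
    rw [← hQmem]
    refine (hTκ (z - c)).trans ?_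
    rw [hR]
    gcongr
    exact (mem_ball_iff_norm.mp hz).le
  -- Comparing with the maximum over the larger parallelogram, instead of values in the ball, only
  -- enlarges the sublevel set.
  have hsub : {z ∈ Metric.ball c ρ | ∃ y ∈ Metric.ball c ρ, |G 0 0 z| < ε * |G 0 0 y|} ⊆
      (fun z => c + z) '' (T '' E) := by
    rintro z ⟨hz, y, hy, hzy⟩
    have hFz : ∀ z, F (T.symm (z - c)) = G 0 0 z := fun z => by simp [hF]
    refine ⟨z - c, ⟨T.symm (z - c), ⟨hpre z hz, ?_⟩, by simp⟩, by ring⟩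
    rw [hFz]
    refine hzy.trans_le ?_
    have : |F (T.symm (y - c))| ≤ |F p₀| := hmax (hpre y hy)
    rw [hFz] at this
    gcongr
  refine (measure_mono hsub).trans ?_
  rw [Set.image_add_left, measure_preimage_add, Complex.volume_ball]
  refine ((hTK E).trans (mul_le_mul_right hmain _)).trans ?_
  rw [← ENNReal.ofReal_mul hK.le, ← ENNReal.ofReal_pow hρ.le,
    ← ENNReal.ofReal_coe_nnreal (p := NNReal.pi), NNReal.coe_real_pi,
    ← ENNReal.ofReal_mul (by positivity), ← ENNReal.ofReal_mul (by positivity)]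
  refine ENNReal.ofReal_le_ofReal ?_
  have hηα : ∀ a, min α₁ α₂ ≤ a → η ^ a ≤ ε ^ (min α₁ α₂ / 2) := by
    intro a ha
    calc η ^ a ≤ η ^ (min α₁ α₂) := Real.rpow_le_rpow_of_exponent_ge hηpos hη1 ha
      _ = ε ^ (min α₁ α₂ / 2) := by
        rw [hη, Real.sqrt_eq_rpow, ← Real.rpow_mul hε.le]; congr 1; ring
  have hX := hηα α₁ (min_le_left _ _)
  have hY := hηα α₂ (min_le_right _ _)
  set X := ε ^ (min α₁ α₂ / 2)
  have hX0 : 0 < X := by positivity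
  calc K * ((C₁ * η ^ α₁ + C₂ * η ^ α₂) * ((R - -R) * (R - -R)))
      ≤ K * ((C₁ * X + C₂ * X) * ((R - -R) * (R - -R))) := by
        have : 0 ≤ (R - -R) * (R - -R) := mul_self_nonneg _
        gcongr
    _ = C₀ * X * (ρ ^ 2 * Real.pi) := by rw [hC₀, hR]; field_simp; ring
    _ ≤ max 1 C₀ * X * (ρ ^ 2 * Real.pi) := by gcongr; exact le_max_right _ _

/-! ### Uniform goodness for finite-dimensional spaces of analytic functions -/

/-- Real linear coordinates on `ℂ` whose two basis vectors lie in a given nonempty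
open set. -/
theorem exists_planeMap_equiv {O : Set ℂ} (hO : IsOpen O) (hne : O.Nonempty) :
    ∃ T : (ℝ × ℝ) ≃L[ℝ] ℂ, T (1, 0) ∈ O ∧ T (0, 1) ∈ O := by
  obtain ⟨v, hv, hv0⟩ : ∃ v ∈ O, v ≠ 0 := by
    obtain ⟨u, hu⟩ := hne
    by_contra! h
    have : O = {0} := Set.eq_singleton_iff_unique_mem.mpr ⟨by rw [← h u hu]; exact hu, h⟩
    exact not_isOpen_singleton (0 : ℂ) (this ▸ hO)
  -- The second vector is the first one times the non-real number `1 + s * I`, which forces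
  -- independence over `ℝ`.
  obtain ⟨s, hs, hs0⟩ : ∃ s : ℝ, v * (1 + s * Complex.I) ∈ O ∧ s ≠ 0 := by
    have hc : Continuous fun s : ℝ => v * (1 + s * Complex.I) := by fun_prop
    have h0 : (0 : ℝ) ∈ (fun s : ℝ => v * (1 + s * Complex.I)) ⁻¹' O := by simpa using hv
    by_contra! h
    have : (fun s : ℝ => v * (1 + s * Complex.I)) ⁻¹' O = {0} :=
      Set.eq_singleton_iff_unique_mem.mpr ⟨h0, fun s hs => h s hs⟩
    exact not_isOpen_singleton (0 : ℝ) (this ▸ hO.preimage hc)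
  have hinj : Function.Injective (planeMap v (v * (1 + s * Complex.I))) := by
    rw [← LinearMap.ker_eq_bot, LinearMap.ker_eq_bot']
    rintro ⟨a, b⟩ h
    rw [planeMap_apply] at h
    have h1 : v * ((a + b : ℝ) + (b * s : ℝ) * Complex.I) = 0 := by
      rw [← h]; push_cast; ring
    have h2 := (mul_eq_zero.mp h1).resolve_left hv0
    have hre := congrArg Complex.re h2
    have him := congrArg Complex.im h2
    simp only [Complex.add_re, Complex.ofReal_re, Complex.mul_re, Complex.I_re, Complex.ofReal_im,
      Complex.I_im, Complex.add_im, Complex.mul_im, Complex.zero_re, Complex.zero_im] at hre him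
    have hb : b = 0 := by
      have : b * s = 0 := by linarith
      exact (mul_eq_zero.mp this).resolve_right hs0
    have ha : a = 0 := by rw [hb] at hre; linarith
    rw [ha, hb]; rfl
  have hfin : Module.finrank ℝ (ℝ × ℝ) = Module.finrank ℝ ℂ := by simp
  refine ⟨(LinearMap.linearEquivOfInjective _ hinj hfin).toContinuousLinearEquiv, ?_, ?_⟩
  · change planeMap _ _ _ ∈ O
    rw [planeMap_apply]; simpa using hv
  · change planeMap _ _ _ ∈ O
    rw [planeMap_apply]; simpa using hs

/-- Near a nonzero combination of analytic functions, all combinations are good with the same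
constants. -/
theorem exists_nhds_isGood {N : ℕ} {h : Fin N → ℂ → ℝ} {z₀ : ℂ} {r₀ : ℝ}
    (hh : ∀ j, AnalyticOnNhd ℝ (h j) (Metric.ball z₀ r₀)) {c₀ : Fin N → ℝ}
    (hc₀ : ∃ z ∈ Metric.ball z₀ r₀, ∑ j, c₀ j * h j z ≠ 0) :
    ∃ s ∈ nhds c₀, ∃ r C α : ℝ, 0 < r ∧ r ≤ r₀ ∧ 1 ≤ C ∧ 0 < α ∧
      ∀ c ∈ s, IsGood C α (fun z => ∑ j, c j * h j z) (Metric.ball z₀ r) := by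
  set B := Metric.ball z₀ r₀ with hB
  obtain ⟨z₁, hz₁, hz₁0⟩ := hc₀
  have hr₀ : 0 < r₀ := dist_nonneg.trans_lt hz₁
  have hz₀ : z₀ ∈ B := Metric.mem_ball_self hr₀
  have hhc : ∀ j, ContinuousOn (h j) B := fun j => (hh j).continuousOn
  -- `O` consists of the displacements from `z₀` at whose endpoint the combination is nonzero;
  -- directions taken from it are directions along which the function does not vanish identically.
  set O : Set ℂ := (fun u => z₀ + u) ⁻¹' (B ∩ (fun z => ∑ j, c₀ j * h j z) ⁻¹' {0}ᶜ) with hO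
  have hOo : IsOpen O := by
    refine IsOpen.preimage (by fun_prop) ?_
    exact (continuousOn_finsetSum _ fun j _ => (hhc j).const_smul (c₀ j)).isOpen_inter_preimage
      Metric.isOpen_ball isOpen_compl_singleton
  obtain ⟨T, hT1, hT2⟩ := exists_planeMap_equiv hOo
    ⟨z₁ - z₀, by simpa [hO] using ⟨hz₁, hz₁0⟩⟩
  set v : Fin 2 → ℂ := fun i => T (if i = 0 then (1, 0) else (0, 1)) with hv
  have hvO : ∀ i, v i ∈ O := by
    intro i; fin_cases i
    · simpa [hv] using hT1
    · simpa [hv] using hT2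
  set D : (Fin N → ℝ) → Fin 2 → ℕ → ℂ → ℝ :=
    fun c i k z => ∑ j, c j * (dirDeriv (v i))^[k] (h j) z with hD
  have hderiv : ∀ c i k p, ∀ s : ℝ, p + s * v i ∈ B →
      HasDerivAt (fun s : ℝ => D c i k (p + s * v i)) (D c i (k + 1) (p + s * v i)) s := by
    intro c i k p s hs
    exact HasDerivAt.fun_sum fun j _ =>
      (hasDerivAt_dirDeriv_iterate (hh j) (v i) p k hs).const_mul (c j)
  have hD0 : ∀ c i z, D c i 0 z = ∑ j, c j * h j z := fun c i z => rfl
  have hℓ : ∀ i, ∃ ℓ, D c₀ i ℓ z₀ ≠ 0 := by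
    intro i
    by_contra! hcon
    have hfan : AnalyticOnNhd ℝ (fun z => ∑ j, c₀ j * h j z) B := by
      have : (fun z => ∑ j, c₀ j * h j z) = ∑ j, fun z => c₀ j * h j z := by
        ext z; simp
      rw [this]
      exact Finset.analyticOnNhd_sum _ fun j _ => analyticOnNhd_const.mul (hh j)
    exact (hvO i).2 (eq_zero_of_forall_directional_deriv_eq_zero (G := fun k => D c₀ i k) hfan
      (fun k s hs => hderiv c₀ i k z₀ s hs) (hvO i).1 hcon)
  choose ℓ hℓ using hℓ
  have hDc : ∀ i, ContinuousAt (fun q : (Fin N → ℝ) × ℂ => D q.1 i (ℓ i) q.2) (c₀, z₀) := by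
    intro i
    refine tendsto_finsetSum _ fun j _ => ?_
    refine ContinuousAt.mul (by fun_prop) ?_
    exact ContinuousAt.comp (f := fun q : (Fin N → ℝ) × ℂ => q.2)
      (analyticOnNhd_dirDeriv_iterate (hh j) (v i) (ℓ i) z₀ hz₀).continuousAt
      continuousAt_snd
  set δ := min |D c₀ 0 (ℓ 0) z₀| |D c₀ 1 (ℓ 1) z₀| / 2 with hδ
  set A := max |D c₀ 0 (ℓ 0) z₀| |D c₀ 1 (ℓ 1) z₀| + 1 with hA
  have hmin : 0 < min |D c₀ 0 (ℓ 0) z₀| |D c₀ 1 (ℓ 1) z₀| :=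
    lt_min (abs_pos.mpr (hℓ 0)) (abs_pos.mpr (hℓ 1))
  have hδp : 0 < δ := by positivity
  have hAp : 0 < A := by
    have := (abs_nonneg (D c₀ 0 (ℓ 0) z₀)).trans (le_max_left _ |D c₀ 1 (ℓ 1) z₀|)
    linarith
  have hev : ∀ i, ∀ᶠ q : (Fin N → ℝ) × ℂ in nhds (c₀, z₀),
      δ ≤ |D q.1 i (ℓ i) q.2| ∧ |D q.1 i (ℓ i) q.2| ≤ A := by
    intro i
    have h1 : δ < |D c₀ i (ℓ i) z₀| := by
      refine (half_lt_self hmin).trans_le ?_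
      fin_cases i
      exacts [min_le_left _ _, min_le_right _ _]
    have h2 : |D c₀ i (ℓ i) z₀| < A := by
      refine lt_of_le_of_lt ?_ (lt_add_one _)
      fin_cases i
      exacts [le_max_left _ _, le_max_right _ _]
    filter_upwards [(hDc i).abs.eventually (lt_mem_nhds h1),
      (hDc i).abs.eventually (gt_mem_nhds h2)] with q hq1 hq2 using ⟨hq1.le, hq2.le⟩
  have hev' := Filter.eventually_all.mpr hev
  rw [nhds_prod_eq, Filter.eventually_prod_iff] at hev'
  obtain ⟨pa, hpa, pb, hpb, hab⟩ := hev'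
  obtain ⟨r₂, hr₂, hr₂b⟩ := Metric.eventually_nhds_iff_ball.mp hpb
  set r₁ := min r₂ r₀
  have hr₁ : 0 < r₁ := lt_min hr₂ hr₀
  obtain ⟨r, C, α, hr, hrr, hC, hα, hgood⟩ := isGood_of_directional_bounds T hδp hAp hr₁ ℓ
  refine ⟨{c | pa c}, hpa, r, C, α, hr, hrr.trans (min_le_right _ _), hC, hα, fun c hc => ?_⟩
  have hsub : Metric.ball z₀ r₁ ⊆ B := Metric.ball_subset_ball (min_le_right _ _)
  have := hgood z₀ (fun i k => D c i k) (fun i k p s hs => hderiv c i k p s (hsub hs))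
    ((continuousOn_finsetSum _ fun j _ => (hhc j).const_smul (c j)).mono hsub) rfl
    (fun i z hz => hab hc (hr₂b z (Metric.ball_subset_ball (min_le_left _ _) hz)) i)
  exact this

/-- Functions in a finite-dimensional space of real analytic functions are uniformly good near any
given point. -/
theorem exists_uniform_isGood {U : Set ℂ} (hU : IsOpen U) {F : Submodule ℝ (ℂ → ℝ)} (hF : F.FG)
    (han : ∀ f ∈ F, AnalyticOnNhd ℝ f U) {z₀ : ℂ} (hz₀ : z₀ ∈ U) :
    ∃ r C α : ℝ, 0 < r ∧ Metric.ball z₀ r ⊆ U ∧ 0 < C ∧ 0 < α ∧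
      ∀ f ∈ F, IsGood C α f (Metric.ball z₀ r) := by
  obtain ⟨r₀, hr₀, hr₀U⟩ := Metric.isOpen_iff.mp hU z₀ hz₀
  set B := Metric.ball z₀ r₀ with hB
  set R : (ℂ → ℝ) →ₗ[ℝ] (B → ℝ) := LinearMap.funLeft ℝ ℝ Subtype.val with hR
  have : FiniteDimensional ℝ (F.map R) := Module.Finite.iff_fg.mpr (hF.map R)
  set b := Module.finBasis ℝ (F.map R)
  set N := Module.finrank ℝ (F.map R)
  choose h hhF hhb using fun j : Fin N => Submodule.mem_map.mp (b j).2
  have hhan : ∀ j, AnalyticOnNhd ℝ (h j) B := fun j => (han _ (hhF j)).mono hr₀U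
  have hne : ∀ c : Fin N → ℝ, c ≠ 0 → ∃ z ∈ B, ∑ j, c j * h j z ≠ 0 := by
    intro c hc
    by_contra! hcon
    refine hc (funext (Fintype.linearIndependent_iff.mp b.linearIndependent c ?_))
    ext z
    have : ∀ j, ((b j : F.map R) : B → ℝ) z = h j z := fun j => by rw [← hhb j]; rfl
    simpa [Finset.sum_apply, this] using hcon z z.2
  have hcomp := (isCompact_sphere (0 : Fin N → ℝ) 1).induction_on
    (p := fun s => ∃ r C α : ℝ, 0 < r ∧ r ≤ r₀ ∧ 1 ≤ C ∧ 0 < α ∧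
      ∀ c ∈ s, IsGood C α (fun z => ∑ j, c j * h j z) (Metric.ball z₀ r))
    ⟨r₀, 1, 1, hr₀, le_rfl, le_rfl, one_pos, fun c hc => absurd hc (Set.notMem_empty c)⟩
    (by
      rintro s t hst ⟨r, C, α, h1, h2, h3, h4, h5⟩
      exact ⟨r, C, α, h1, h2, h3, h4, fun c hc => h5 c (hst hc)⟩)
    (by
      rintro s t ⟨r, C, α, h1, h2, h3, h4, h5⟩ ⟨r', C', α', h1', h2', h3', h4', h5'⟩
      refine ⟨min r r', max C C', min α α', lt_min h1 h1', (min_le_left _ _).trans h2,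
        h3.trans (le_max_left _ _), lt_min h4 h4', ?_⟩
      rintro c (hc | hc)
      · exact (h5 c hc).mono (le_max_left _ _) (h3.trans (le_max_left _ _)) (min_le_left _ _)
          (lt_min h4 h4').le (Metric.ball_subset_ball (min_le_left _ _))
      · exact (h5' c hc).mono (le_max_right _ _) (h3.trans (le_max_left _ _)) (min_le_right _ _)
          (lt_min h4 h4').le (Metric.ball_subset_ball (min_le_right _ _)))
    (by
      intro c hc
      have hc0 : c ≠ 0 := by
        rintro rfl
        simp at hc
      obtain ⟨s, hs, hs'⟩ := exists_nhds_isGood hhan (hne c hc0)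
      exact ⟨s, mem_nhdsWithin_of_mem_nhds hs, hs'⟩)
  obtain ⟨r, C, α, hr, hrr, hC, hα, hgood⟩ := hcomp
  have hsub : Metric.ball z₀ r ⊆ B := Metric.ball_subset_ball hrr
  refine ⟨r, C, α, hr, hsub.trans hr₀U, by linarith, hα, fun f hf => ?_⟩
  set c : Fin N → ℝ := ⇑(b.repr ⟨R f, Submodule.mem_map_of_mem hf⟩)
  have hfc : ∀ z ∈ B, f z = ∑ j, c j * h j z := by
    intro z hz
    have h1 := congrArg (fun g : F.map R => (g : B → ℝ) ⟨z, hz⟩)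
      (b.sum_repr ⟨R f, Submodule.mem_map_of_mem hf⟩)
    have h2 : ∀ j, ((b j : F.map R) : B → ℝ) ⟨z, hz⟩ = h j z := fun j => by rw [← hhb j]; rfl
    have h3 : R f ⟨z, hz⟩ = f z := rfl
    simp only [Submodule.coe_sum, Submodule.coe_smul, Finset.sum_apply, Pi.smul_apply, h2, h3,
      smul_eq_mul] at h1
    exact h1.symm
  by_cases hc0 : c = 0
  · refine isGood_of_eqOn_zero fun z hz => ?_
    rw [hfc z (hsub hz), hc0]; simp
  -- Goodness is unchanged by nonzero scalars, so coefficients on the unit sphere suffice.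
  · have hn : ‖c‖ ≠ 0 := norm_ne_zero_iff.mpr hc0
    have := (hgood (‖c‖⁻¹ • c) (by simp [norm_smul, hn])).smul hn
    refine this.congr fun z hz => ?_
    rw [hfc z (hsub hz)]
    simp only [Finset.mul_sum]
    refine Finset.sum_congr rfl fun j _ => ?_
    simp only [Pi.smul_apply, smul_eq_mul]
    field_simp

/-! ### Bases of discrete subgroups and covolumes as Gram determinants -/

theorem real_span_int_span {E : Type*} [AddCommGroup E] [Module ℝ E] (s : Set E) :
    Submodule.span ℝ (AddSubgroup.closure s : Set E) = Submodule.span ℝ s := by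
  refine le_antisymm (Submodule.span_le.mpr ?_) (Submodule.span_mono AddSubgroup.subset_closure)
  have : AddSubgroup.closure s ≤ (Submodule.span ℝ s).toAddSubgroup :=
    (AddSubgroup.closure_le _).mpr Submodule.subset_span
  exact this

/-- The square of the covolume is the Gram determinant. -/
theorem covol_closure_sq {E : Type*} [NormedAddCommGroup E] [InnerProductSpace ℝ E]
    [FiniteDimensional ℝ E] [MeasurableSpace E] [BorelSpace E] {k : ℕ} {v : Fin k → E}
    (hv : LinearIndependent ℝ v) :
    covol (AddSubgroup.closure (Set.range v)) ^ 2 =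
      (Matrix.of fun i j => inner ℝ (v i) (v j)).det := by
  set Γ := AddSubgroup.closure (Set.range v) with hΓ
  set W := Submodule.span ℝ (Γ : Set E) with hW
  have hWv : W = Submodule.span ℝ (Set.range v) := real_span_int_span _
  set b : Module.Basis (Fin k) ℝ W :=
    (Module.Basis.span hv).map (LinearEquiv.ofEq _ _ hWv.symm) with hb
  have hbv : ∀ i, (b i : E) = v i := fun i => by
    simp [hb, Module.Basis.span_apply]
  have hL : (AddSubgroup.toIntSubmodule Γ).comap (W.subtype.restrictScalars ℤ) =
      Submodule.span ℤ (Set.range b) := by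
    apply Submodule.map_injective_of_injective
      (f := W.subtype.restrictScalars ℤ) W.injective_subtype
    rw [Submodule.map_comap_eq, Submodule.map_span, ← Set.range_comp]
    have h1 : (W.subtype.restrictScalars ℤ) ∘ b = v := funext hbv
    have h2 : Submodule.span ℤ (Set.range v) = AddSubgroup.toIntSubmodule Γ := by
      rw [hΓ, ← Submodule.span_int_eq_addSubgroupClosure]; rfl
    rw [h1, h2]
    refine inf_eq_right.mpr ?_
    intro x hx
    exact ⟨⟨x, Submodule.subset_span hx⟩, rfl⟩
  have hcard : Module.finrank ℝ W = k := by
    rw [Module.finrank_eq_card_basis b, Fintype.card_fin]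
  set o : OrthonormalBasis (Fin k) ℝ W := (stdOrthonormalBasis ℝ W).reindex (finCongr hcard)
  have hcov : covol Γ = |o.toBasis.det b| := by
    unfold covol
    rw [hL]
    rw [ZLattice.covolume_eq_measure_fundamentalDomain _ _ (ZSpan.isAddFundamentalDomain b volume),
      ZSpan.measureReal_fundamentalDomain _ _ o.toBasis,
      measureReal_congr (ZSpan.fundamentalDomain_ae_parallelepiped o.toBasis volume)]
    have : (volume : Measure W).real (parallelepiped o.toBasis) = 1 := by
      rw [measureReal_def, OrthonormalBasis.coe_toBasis, o.volume_parallelepiped]; rfl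
    rw [this, mul_one]
  rw [hcov, sq_abs, Module.Basis.det_apply, sq]
  -- The transposed coordinate matrix times itself has the inner products of the `b i` as entries,
  -- since `o` is orthonormal.
  nth_rewrite 1 [← Matrix.det_transpose]
  rw [← Matrix.det_mul]
  congr 1
  ext i j
  rw [Matrix.mul_apply, Matrix.of_apply, ← hbv i, ← hbv j, ← Submodule.coe_inner,
    ← o.sum_inner_mul_inner (b i) (b j)]
  refine Finset.sum_congr rfl fun l _ => ?_
  simp only [Matrix.transpose_apply, Module.Basis.toMatrix_apply, OrthonormalBasis.coe_toBasis_repr_apply,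
    OrthonormalBasis.repr_apply_apply]
  rw [real_inner_comm]

/-- A subgroup of `Λ` is generated by real-linearly independent elements. -/
theorem exists_linearIndependent_closure_eq {n : ℕ} {Γ : AddSubgroup (Space n)} (hΓ : Γ ≤ Lam n) :
    ∃ (k : ℕ) (v : Fin k → Space n), LinearIndependent ℝ v ∧
      Γ = AddSubgroup.closure (Set.range v) := by
  set L := AddSubgroup.toIntSubmodule Γ with hL
  set e : Module.Basis (Fin 2 ⊕ Fin n) ℝ (Space n) :=
    (EuclideanSpace.basisFun (Fin 2 ⊕ Fin n) ℝ).toBasis with he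
  have hle : L ≤ Submodule.span ℤ (Set.range e) := by
    intro x hx
    obtain ⟨p, q, rfl⟩ := hΓ hx
    rw [e.mem_span_iff_repr_mem ℤ]
    rintro (i | i)
    · fin_cases i
      · exact ⟨p, by simp [he]⟩
      · exact ⟨0, by simp [he]⟩
    · exact ⟨q i, by simp [he]⟩
  have hdisc : DiscreteTopology L :=
    DiscreteTopology.of_subset (s := (Submodule.span ℤ (Set.range e) : Set (Space n)))
      (inferInstanceAs (DiscreteTopology (Submodule.span ℤ (Set.range e)))) hle
  set b := Module.finBasis ℤ L
  have h1 : Submodule.span ℤ (Set.range fun i => (b i : Space n)) = L := by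
    have : (fun i => (b i : Space n)) = L.subtype ∘ b := rfl
    rw [this, Set.range_comp, ← Submodule.map_span, b.span_eq, Submodule.map_top,
      Submodule.range_subtype]
  refine ⟨_, fun i => (b i : Space n), ?_, ?_⟩
  -- Discreteness is essential: it makes the real rank equal to the integral rank, whereas
  -- independence over `ℤ` alone does not give independence over `ℝ`.
  · rw [linearIndependent_iff_card_eq_finrank_span,
      Real.finrank_eq_int_finrank_of_discrete (by rw [h1]; exact hdisc), Set.finrank, h1,
      Fintype.card_fin]
  · rw [← Submodule.span_int_eq_addSubgroupClosure, h1]; rfl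

section

/-! ### Gram determinants -/

/-- The determinant is the product of the `1 + λ_i` over the eigenvalues `λ_i ≥ 0` of `P`; the
product formula is the characteristic polynomial evaluated at `-1`. -/
theorem one_le_det_one_add {m : Type*} [Fintype m] [DecidableEq m] {P : Matrix m m ℝ}
    (hP : P.PosSemidef) : 1 ≤ (1 + P).det := by
  have h1 := congrArg (Polynomial.eval (-1)) hP.isHermitian.charpoly_eq
  rw [Matrix.eval_charpoly, Polynomial.eval_prod] at h1
  have h2 : Matrix.scalar m (-1 : ℝ) - P = -(1 + P) := by
    rw [map_neg, map_one, neg_add, sub_eq_add_neg]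
  rw [h2, Matrix.det_neg] at h1
  have h3 : ∏ i, Polynomial.eval (-1 : ℝ) (Polynomial.X - Polynomial.C
      ((hP.isHermitian.eigenvalues i : ℝ))) =
      (-1) ^ Fintype.card m * ∏ i, (1 + hP.isHermitian.eigenvalues i) := by
    rw [← Finset.card_univ, ← Finset.prod_const, ← Finset.prod_mul_distrib]
    refine Finset.prod_congr rfl fun i _ => ?_
    simp; ring
  have h4 : (1 + P).det = ∏ i, (1 + hP.isHermitian.eigenvalues i) := by
    have := h1.trans h3
    exact mul_left_cancel₀ (pow_ne_zero _ (by norm_num)) this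
  rw [h4]
  refine Finset.one_le_prod fun i _ => ?_
  change (1 : ℝ) ≤ 1 + hP.isHermitian.eigenvalues i
  linarith [hP.eigenvalues_nonneg i]

theorem posSemidef_transpose_mul_self {l m : Type*} [Fintype l] [Fintype m]
    (M : Matrix l m ℝ) : (M.transpose * M).PosSemidef := by
  have := Matrix.posSemidef_conjTranspose_mul_self M
  rwa [Matrix.conjTranspose_eq_transpose_of_trivial] at this

/-- A Gram determinant is at least the square of each maximal minor. -/
theorem sq_det_submatrix_le_det_gram {l m : Type*} [Fintype l] [Fintype m] [DecidableEq m]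
    (M : Matrix l m ℝ) {σ : m → l} (hσ : Function.Injective σ) :
    (M.submatrix σ id).det ^ 2 ≤ (M.transpose * M).det := by
  classical
  set B := M.submatrix σ id with hB
  by_cases h0 : B.det = 0
  · rw [h0]; simpa using (posSemidef_transpose_mul_self M).det_nonneg
  set N := M.submatrix (Subtype.val : {a // a ∉ Set.range σ} → l) id with hN
  have hsum : M.transpose * M = B.transpose * B + N.transpose * N := by
    ext i j
    simp only [Matrix.add_apply, Matrix.mul_apply, Matrix.transpose_apply, hB, hN,
      Matrix.submatrix_apply, id]
    rw [← Fintype.sum_subtype_add_sum_subtype (fun a => a ∈ Set.range σ)]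
    congr 1
    convert! (Fintype.sum_equiv (Equiv.ofInjective σ hσ) (fun l => M (σ l) i * M (σ l) j)
      (fun a => M a.1 i * M a.1 j) fun _ => rfl).symm
  have hu : IsUnit B.det := isUnit_iff_ne_zero.mpr h0
  -- Factoring out the invertible block `B` of chosen rows leaves the identity plus a positive
  -- semidefinite matrix, so a single term of Cauchy–Binet is bounded without the full formula.
  have hfac : M.transpose * M =
      B.transpose * (1 + (N * B⁻¹).transpose * (N * B⁻¹)) * B := by
    rw [hsum, Matrix.mul_add, Matrix.add_mul, Matrix.mul_one, Matrix.transpose_mul]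
    congr 1
    calc N.transpose * N = (B⁻¹ * B).transpose * (N.transpose * N) * (B⁻¹ * B) := by
          rw [Matrix.nonsing_inv_mul _ hu]; simp
      _ = _ := by rw [Matrix.transpose_mul]; simp only [Matrix.mul_assoc]
  rw [hfac, Matrix.det_mul, Matrix.det_mul, Matrix.det_transpose]
  have := one_le_det_one_add (posSemidef_transpose_mul_self (N * B⁻¹))
  nlinarith [sq_nonneg B.det]

/-! ### The flow in coordinates -/

/-- The value `p + ∑ q_i z_i` at `(p, 0, q)`. -/
noncomputable def affineVal {n : ℕ} (z : Fin n → ℂ) (v : Fin 2 ⊕ Fin n → ℝ) : ℂ :=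
  v (Sum.inl 0) + ∑ i, v (Sum.inr i) * z i

/-- The exponent of the first two diagonal entries of `g_t`. -/
noncomputable def topExp {n : ℕ} (t : Fin n → ℝ) : ℝ :=
  ((n : ℝ) - 1) / (2 * (n : ℝ)) * ∑ i, t i

variable {n : ℕ} {κ : Type*}

theorem flow_mul_inl_zero (t : Fin n → ℝ) (z : Fin n → ℂ) (V : Matrix (Fin 2 ⊕ Fin n) κ ℝ)
    (j : κ) : (gMat t * uMat z * V) (Sum.inl 0) j =
      Real.exp (topExp t) * (affineVal z fun a => V a j).re := by
  rw [Matrix.mul_assoc, gMat, Matrix.diagonal_mul, Matrix.mul_apply, Fintype.sum_sum_type]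
  simp [uMat, topExp, affineVal, mul_comm]

theorem flow_mul_inl_one (t : Fin n → ℝ) (z : Fin n → ℂ) (V : Matrix (Fin 2 ⊕ Fin n) κ ℝ)
    (j : κ) (hV : V (Sum.inl 1) j = 0) : (gMat t * uMat z * V) (Sum.inl 1) j =
      Real.exp (topExp t) * (affineVal z fun a => V a j).im := by
  rw [Matrix.mul_assoc, gMat, Matrix.diagonal_mul, Matrix.mul_apply, Fintype.sum_sum_type]
  simp [uMat, topExp, affineVal, mul_comm, hV]

theorem flow_mul_inr (t : Fin n → ℝ) (z : Fin n → ℂ) (V : Matrix (Fin 2 ⊕ Fin n) κ ℝ)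
    (i : Fin n) (j : κ) : (gMat t * uMat z * V) (Sum.inr i) j =
      Real.exp (-t i) * V (Sum.inr i) j := by
  rw [Matrix.mul_assoc, gMat, Matrix.diagonal_mul, Matrix.mul_apply, Fintype.sum_sum_type]
  simp [uMat, Matrix.one_apply]

theorem det_flow_ne_zero (t : Fin n → ℝ) (z : Fin n → ℂ) : (gMat t * uMat z).det ≠ 0 := by
  rw [Matrix.det_mul, gMat, Matrix.det_diagonal, uMat, Matrix.det_fromBlocks_zero₂₁]
  simp only [Matrix.det_one, mul_one]
  refine Finset.prod_ne_zero_iff.mpr ?_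
  rintro (i | i) - <;> simp

theorem flowCovol_nonneg (t : Fin n → ℝ) (z : Fin n → ℂ) (Γ : AddSubgroup (Space n)) :
    0 ≤ flowCovol t z Γ := ENNReal.toReal_nonneg

/-- A nonzero subgroup of `Λ` is described by an integer matrix with independent columns, whose
Gram determinants compute the covolumes. -/
theorem exists_matrix_flowCovol_sq {Γ : AddSubgroup (Space n)} (hΓ : Γ ≤ Lam n) (hΓ0 : Γ ≠ ⊥) :
    ∃ (k : ℕ) (V : Matrix (Fin 2 ⊕ Fin n) (Fin k) ℝ), 1 ≤ k ∧ k ≤ n + 2 ∧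
      LinearIndependent ℝ V.col ∧ (∀ j, V (Sum.inl 1) j = 0) ∧
      (∃ Z : Matrix (Fin 2 ⊕ Fin n) (Fin k) ℤ, V = Z.map (Int.cast : ℤ → ℝ)) ∧
      ∀ t z, flowCovol t z Γ ^ 2 =
        ((gMat t * uMat z * V).transpose * (gMat t * uMat z * V)).det := by
  obtain ⟨k, v, hv, rfl⟩ := exists_linearIndependent_closure_eq hΓ
  set V : Matrix (Fin 2 ⊕ Fin n) (Fin k) ℝ := Matrix.of fun a j => v j a with hV
  have hmem : ∀ j, v j ∈ Lam n := fun j => hΓ (AddSubgroup.subset_closure ⟨j, rfl⟩)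
  choose p q hpq using hmem
  refine ⟨k, V, ?_, ?_, ?_, ?_, ?_, ?_⟩
  · by_contra hk
    obtain rfl : k = 0 := by omega
    apply hΓ0
    simp
  · have := hv.fintype_card_le_finrank
    simp only [finrank_euclideanSpace, Fintype.card_sum, Fintype.card_fin] at this
    omega
  · have := hv.map' (WithLp.linearEquiv 2 ℝ (Fin 2 ⊕ Fin n → ℝ)).toLinearMap
      (LinearEquiv.ker _)
    exact this
  · intro j
    simp [hV, hpq j]
  · refine ⟨Matrix.of fun a j => Sum.elim ![p j, 0] (q j) a, ?_⟩
    ext a j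
    rcases a with a | a
    · fin_cases a <;> simp [hV, hpq j]
    · simp [hV, hpq j]
  · intro t z
    set A := gMat t * uMat z with hA
    -- Injectivity keeps the image vectors independent, so the Gram formula applies to the image
    -- group.
    have hinj : Function.Injective (Matrix.toEuclideanLin A) := by
      have h1 := Matrix.mulVec_injective_of_det_ne_zero (det_flow_ne_zero t z)
      intro x y hxy
      have := congrArg (WithLp.ofLp) hxy
      simp only [Matrix.ofLp_toLpLin, Matrix.toLin'_apply] at this
      exact WithLp.ofLp_injective 2 (h1 this)
    have hind := hv.map' (Matrix.toEuclideanLin A) (LinearMap.ker_eq_bot.mpr hinj)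
    unfold flowCovol
    rw [AddMonoidHom.map_closure, ← Set.range_comp]
    refine (covol_closure_sq hind).trans ?_
    congr 1
    ext i j
    simp only [Matrix.of_apply, Function.comp, Matrix.mul_apply (M := (A * V).transpose),
      Matrix.transpose_apply, PiLp.inner_apply, Matrix.ofLp_toLpLin, Matrix.toLin'_apply]
    refine Finset.sum_congr rfl fun a _ => ?_
    simp [Matrix.mulVec, dotProduct, Matrix.mul_apply, hV, mul_comm]

end

/-! ### Squared covolumes in a fixed finite-dimensional space of analytic functions -/

section

/-- The span of the constants and of the real and imaginary parts of the components of `f`. -/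
def coordSpan {n : ℕ} (f : ℂ → Fin n → ℂ) : Submodule ℝ (ℂ → ℝ) :=
  Submodule.span ℝ ({1} ∪ (Set.range (fun i z => (f z i).re) ∪ Set.range fun i z => (f z i).im))

variable {n : ℕ} {f : ℂ → Fin n → ℂ}

theorem one_mem_coordSpan : (1 : ℂ → ℝ) ∈ coordSpan f :=
  Submodule.subset_span (Or.inl rfl)

theorem re_mem_coordSpan (i : Fin n) : (fun z => (f z i).re) ∈ coordSpan f :=
  Submodule.subset_span (Or.inr (Or.inl ⟨i, rfl⟩))

theorem im_mem_coordSpan (i : Fin n) : (fun z => (f z i).im) ∈ coordSpan f :=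
  Submodule.subset_span (Or.inr (Or.inr ⟨i, rfl⟩))

theorem coordSpan_fg : (coordSpan f).FG :=
  Submodule.fg_span ((Set.finite_singleton _).union
    ((Set.finite_range _).union (Set.finite_range _)))

/-- Containing the constants makes the powers of the span increase, so subgroups of different ranks
fit into one power. -/
theorem one_le_coordSpan : 1 ≤ coordSpan f :=
  Submodule.one_le.mpr one_mem_coordSpan

theorem prod_mem_pow_card {R A ι : Type*} [CommSemiring R] [CommSemiring A] [Algebra R A]
    (N : Submodule R A) (s : Finset ι) (x : ι → A) (hx : ∀ i ∈ s, x i ∈ N) :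
    ∏ i ∈ s, x i ∈ N ^ s.card := by
  classical
  induction s using Finset.induction_on with
  | empty => simp [Submodule.one_le.mp le_rfl]
  | insert a s ha ih =>
    rw [Finset.prod_insert ha, Finset.card_insert_of_notMem ha, pow_succ']
    exact Submodule.mul_mem_mul (hx a (Finset.mem_insert_self _ _))
      (ih fun i hi => hx i (Finset.mem_insert_of_mem hi))

/-- Real and imaginary parts of holomorphic functions are real analytic, and real analyticity
survives linear combinations and products. -/
theorem analyticOnNhd_of_mem_coordSpan_pow {U : Set ℂ} (hf : AnalyticOnNhd ℂ f U) (m : ℕ) :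
    ∀ g ∈ coordSpan f ^ m, AnalyticOnNhd ℝ g U := by
  let A : Submodule ℝ (ℂ → ℝ) :=
    { carrier := {g | AnalyticOnNhd ℝ g U}
      add_mem' := fun ha hb => ha.add hb
      zero_mem' := analyticOnNhd_const
      smul_mem' := fun c g hg => analyticOnNhd_const.mul hg }
  have hfR : ∀ i, AnalyticOnNhd ℝ (fun z => f z i) U := fun i =>
    ((ContinuousLinearMap.proj (R := ℂ) (φ := fun _ : Fin n => ℂ) i).comp_analyticOnNhd
      hf).restrictScalars
  have h1 : coordSpan f ≤ A := by
    refine Submodule.span_le.mpr ?_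
    rintro g (rfl | ⟨i, rfl⟩ | ⟨i, rfl⟩)
    · exact analyticOnNhd_const
    · exact Complex.reCLM.comp_analyticOnNhd (hfR i)
    · exact Complex.imCLM.comp_analyticOnNhd (hfR i)
  suffices coordSpan f ^ m ≤ A from fun g hg => this hg
  induction m with
  | zero =>
    rw [pow_zero, Submodule.one_le]
    exact analyticOnNhd_const
  | succ m ih =>
    rw [pow_succ, Submodule.mul_le]
    exact fun g hg h hh => AnalyticOnNhd.mul (ih hg) (h1 hh)

theorem flow_entry_mem_coordSpan (t : Fin n → ℝ) {k : ℕ} (V : Matrix (Fin 2 ⊕ Fin n) (Fin k) ℝ)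
    (hV : ∀ j, V (Sum.inl 1) j = 0) (a : Fin 2 ⊕ Fin n) (j : Fin k) :
    (fun z => (gMat t * uMat (f z) * V) a j) ∈ coordSpan f := by
  rcases a with a | i
  · fin_cases a
    · have : (fun z => (gMat t * uMat (f z) * V) (Sum.inl 0) j) = Real.exp (topExp t) •
          (V (Sum.inl 0) j • (1 : ℂ → ℝ) + ∑ i, V (Sum.inr i) j • fun z => (f z i).re) := by
        ext z
        simp [flow_mul_inl_zero, affineVal]
      exact this ▸ Submodule.smul_mem _ _ (Submodule.add_mem _
        (Submodule.smul_mem _ _ one_mem_coordSpan)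
        (Submodule.sum_mem _ fun i _ => Submodule.smul_mem _ _ (re_mem_coordSpan i)))
    · have : (fun z => (gMat t * uMat (f z) * V) (Sum.inl 1) j) = Real.exp (topExp t) •
          (∑ i, V (Sum.inr i) j • fun z => (f z i).im) := by
        ext z
        simp [flow_mul_inl_one, affineVal, hV]
      exact this ▸ Submodule.smul_mem _ _
        (Submodule.sum_mem _ fun i _ => Submodule.smul_mem _ _ (im_mem_coordSpan i))
  · have : (fun z => (gMat t * uMat (f z) * V) (Sum.inr i) j) =
        (Real.exp (-t i) * V (Sum.inr i) j) • (1 : ℂ → ℝ) := by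
      ext z
      simp [flow_mul_inr]
    exact this ▸ Submodule.smul_mem _ _ one_mem_coordSpan

/-- Each Gram entry is quadratic in the span, so the Leibniz formula has degree `2 * k`, at most `2
* (n + 2)`. That this power depends on neither `t` nor `V` is the source of uniformity. -/
theorem det_gram_mem_coordSpan_pow (t : Fin n → ℝ) {k : ℕ} (hk : k ≤ n + 2)
    (V : Matrix (Fin 2 ⊕ Fin n) (Fin k) ℝ) (hV : ∀ j, V (Sum.inl 1) j = 0) :
    (fun z => ((gMat t * uMat (f z) * V).transpose * (gMat t * uMat (f z) * V)).det) ∈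
      coordSpan f ^ (2 * (n + 2)) := by
  set M : Fin 2 ⊕ Fin n → Fin k → ℂ → ℝ := fun a j z => (gMat t * uMat (f z) * V) a j with hM
  have hMm : ∀ a j, M a j ∈ coordSpan f := fun a j => flow_entry_mem_coordSpan t V hV a j
  have hG : ∀ i j, ∑ a, M a i * M a j ∈ coordSpan f ^ 2 := fun i j =>
    Submodule.sum_mem _ fun a _ => by
      rw [sq]; exact Submodule.mul_mem_mul (hMm a i) (hMm a j)
  have hdet : (fun z => ((gMat t * uMat (f z) * V).transpose *
      (gMat t * uMat (f z) * V)).det) = ∑ σ : Equiv.Perm (Fin k),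
        ((Equiv.Perm.sign σ : ℤ) : ℝ) • ∏ j, ∑ a, M a (σ j) * M a j := by
    ext z
    rw [Matrix.det_apply']
    simp only [Finset.sum_apply, Pi.smul_apply, Finset.prod_apply, Pi.mul_apply, smul_eq_mul,
      Matrix.mul_apply (M := (gMat t * uMat (f z) * V).transpose), Matrix.transpose_apply, hM]
  rw [hdet]
  refine Submodule.sum_mem _ fun σ _ => Submodule.smul_mem _ _ ?_
  have h1 := prod_mem_pow_card (coordSpan f ^ 2) Finset.univ
    (fun j => ∑ a, M a (σ j) * M a j) fun j _ => hG _ _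
  rw [Finset.card_univ, Fintype.card_fin, ← pow_mul] at h1
  exact pow_le_pow_right₀ one_le_coordSpan (by omega) h1

/-- The covolume functions are uniformly good near every point. -/
theorem exists_isGood_flowCovol {U : Set ℂ} (hU : IsOpen U) (hf : AnalyticOnNhd ℂ f U) {z₀ : ℂ}
    (hz₀ : z₀ ∈ U) :
    ∃ r : ℝ, 0 < r ∧ Metric.ball z₀ r ⊆ U ∧ ∃ C α : ℝ, 0 < C ∧ 0 < α ∧
      ∀ t : Fin n → ℝ, ∀ Γ : AddSubgroup (Space n), Γ ≤ Lam n → Γ ≠ ⊥ →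
        IsGood C α (fun z => flowCovol t (f z) Γ) (Metric.ball z₀ r) := by
  obtain ⟨r, C, α, hr, hrU, hC, hα, h⟩ := exists_uniform_isGood hU
    (coordSpan_fg (f := f) |>.pow (2 * (n + 2))) (analyticOnNhd_of_mem_coordSpan_pow hf _) hz₀
  refine ⟨r, hr, hrU, C, 2 * α, hC, by positivity, fun t Γ hΓ hΓ0 => ?_⟩
  obtain ⟨k, V, -, hk, -, hV, -, hcov⟩ := exists_matrix_flowCovol_sq hΓ hΓ0
  refine IsGood.of_sq ?_
  simp only [hcov]
  exact h _ (det_gram_mem_coordSpan_pow t hk V hV)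

end

/-! ### Nonvanishing of affine combinations and uniform lower bounds -/

section

/-- A pointwise nonvanishing family of functions, continuous in a parameter from a compact set, is
uniformly nonvanishing. -/
theorem exists_uniform_lower_bound {X Z : Type*} [TopologicalSpace X] {K : Set X}
    (hK : IsCompact K) {B : Set Z} {Φ : X → Z → ℝ} (hΦ : ∀ z ∈ B, Continuous fun x => Φ x z)
    (hne : ∀ x ∈ K, ∃ z ∈ B, Φ x z ≠ 0) :
    ∃ ρ : ℝ, 0 < ρ ∧ ∀ x ∈ K, ∃ z ∈ B, ρ ≤ |Φ x z| := by
  refine hK.induction_on (p := fun s => ∃ ρ : ℝ, 0 < ρ ∧ ∀ x ∈ s, ∃ z ∈ B, ρ ≤ |Φ x z|)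
    ⟨1, one_pos, fun x hx => absurd hx (Set.notMem_empty x)⟩ ?_ ?_ ?_
  · rintro s t hst ⟨ρ, h0, h⟩
    exact ⟨ρ, h0, fun x hx => h x (hst hx)⟩
  · rintro s t ⟨ρ, h0, h⟩ ⟨ρ', h0', h'⟩
    refine ⟨min ρ ρ', lt_min h0 h0', ?_⟩
    rintro x (hx | hx)
    · obtain ⟨z, hz, hzρ⟩ := h x hx
      exact ⟨z, hz, (min_le_left _ _).trans hzρ⟩
    · obtain ⟨z, hz, hzρ⟩ := h' x hx
      exact ⟨z, hz, (min_le_right _ _).trans hzρ⟩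
  · intro x hx
    obtain ⟨z, hz, hxz⟩ := hne x hx
    have h1 : |Φ x z| / 2 < |Φ x z| := half_lt_self (abs_pos.mpr hxz)
    exact ⟨_, mem_nhdsWithin_of_mem_nhds ((hΦ z hz).abs.continuousAt.eventually (lt_mem_nhds h1)),
      |Φ x z| / 2, half_pos (abs_pos.mpr hxz), fun y hy => ⟨z, hz, le_of_lt hy⟩⟩

variable {n : ℕ} {U : Set ℂ} {f : ℂ → Fin n → ℂ}

theorem continuous_affineVal (z : Fin n → ℂ) : Continuous (affineVal z) := by
  unfold affineVal; fun_prop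

theorem analyticOnNhd_affineVal (hf : AnalyticOnNhd ℂ f U) (v : Fin 2 ⊕ Fin n → ℝ) :
    AnalyticOnNhd ℂ (fun z => affineVal (f z) v) U := by
  have h : ∀ i, AnalyticOnNhd ℂ (fun z => f z i) U := fun i =>
    (ContinuousLinearMap.proj (R := ℂ) (φ := fun _ : Fin n => ℂ) i).comp_analyticOnNhd hf
  have : (fun z => affineVal (f z) v) =
      (fun _ => (v (Sum.inl 0) : ℂ)) + ∑ i, fun z => (v (Sum.inr i) : ℂ) * f z i := by
    ext z; simp [affineVal]
  rw [this]
  exact analyticOnNhd_const.add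
    (Finset.analyticOnNhd_sum _ fun i _ => analyticOnNhd_const.mul (h i))

theorem affineVal_sub_smul (z : Fin n → ℂ) (v w : Fin 2 ⊕ Fin n → ℝ) (s : ℝ) :
    affineVal z (w - s • v) = affineVal z w - s * affineVal z v := by
  simp only [affineVal, Pi.sub_apply, Pi.smul_apply, smul_eq_mul, Complex.ofReal_sub,
    Complex.ofReal_mul, sub_mul, Finset.sum_sub_distrib, mul_add, Finset.mul_sum, mul_assoc]
  ring

theorem affineVal_smul (z : Fin n → ℂ) (v : Fin 2 ⊕ Fin n → ℝ) (s : ℝ) :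
    affineVal z (s • v) = s * affineVal z v := by
  simp only [affineVal, Pi.smul_apply, smul_eq_mul, Complex.ofReal_mul, mul_add, Finset.mul_sum,
    mul_assoc]

/-- A real affine combination of the components of `f` vanishing on an open subset is trivial. -/
theorem eq_zero_of_affineVal_eq_zero (hf : AnalyticOnNhd ℂ f U) (hU : IsPreconnected U)
    (hind : IndepWithOne U f) {O : Set ℂ} (hO : IsOpen O) (hOne : O.Nonempty) (hOU : O ⊆ U)
    {v : Fin 2 ⊕ Fin n → ℝ} (hv1 : v (Sum.inl 1) = 0) (hv : ∀ z ∈ O, affineVal (f z) v = 0) :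
    v = 0 := by
  obtain ⟨z₁, hz₁⟩ := hOne
  have h0 : Set.EqOn (fun z => affineVal (f z) v) 0 U :=
    (analyticOnNhd_affineVal hf v).eqOn_zero_of_preconnected_of_eventuallyEq_zero hU (hOU hz₁)
      (by filter_upwards [hO.mem_nhds hz₁] with z hz using hv z hz)
  have h1 := Fintype.linearIndependent_iff.mp hind
    (Fin.cons (v (Sum.inl 0)) fun i => v (Sum.inr i)) (by
      ext z
      have := h0 z.2
      simp only [affineVal, Pi.zero_apply] at this
      rw [Fin.sum_univ_succ]
      simpa using this)
  ext a
  rcases a with a | i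
  · fin_cases a
    · exact h1 0
    · exact hv1
  · simpa using h1 i.succ

/-- The imaginary part of `conj (L v) * L w` where `L` is `affineVal z`. -/
noncomputable def crossVal (z : Fin n → ℂ) (v w : Fin 2 ⊕ Fin n → ℝ) : ℝ :=
  (affineVal z v).re * (affineVal z w).im - (affineVal z w).re * (affineVal z v).im

/-- The entry `v a = 1` makes `affineVal (f z) v` nonzero somewhere, hence on a small ball. If
`crossVal` vanished there, the quotient for `w` over `v` would be holomorphic and real-valued, thus
a real constant `s`, and independence would give `w = s • v`. The entries at `b` exclude this. -/
theorem exists_crossVal_ne_zero (hf : AnalyticOnNhd ℂ f U) (hU : IsPreconnected U)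
    (hind : IndepWithOne U f) {O : Set ℂ} (hO : IsOpen O) (hOne : O.Nonempty) (hOU : O ⊆ U)
    {v w : Fin 2 ⊕ Fin n → ℝ} (hv1 : v (Sum.inl 1) = 0) (hw1 : w (Sum.inl 1) = 0)
    {a b : Fin 2 ⊕ Fin n} (hva : v a = 1) (hvb : v b = 0) (hwb : w b = 1) :
    ∃ z ∈ O, crossVal (f z) v w ≠ 0 := by
  by_contra! hcon
  obtain ⟨z₁, hz₁, hz₁0⟩ : ∃ z ∈ O, affineVal (f z) v ≠ 0 := by
    by_contra! h
    have := eq_zero_of_affineVal_eq_zero hf hU hind hO hOne hOU hv1 h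
    rw [this] at hva
    simp at hva
  have hcont := (analyticOnNhd_affineVal (hf.mono hOU) v).continuousOn
  obtain ⟨r, hr, hball⟩ := Metric.isOpen_iff.mp
    (hcont.isOpen_inter_preimage hO isOpen_compl_singleton) z₁ ⟨hz₁, hz₁0⟩
  have hsubU : Metric.ball z₁ r ⊆ U := fun z hz => hOU (hball hz).1
  have hg : AnalyticOnNhd ℂ (fun z => affineVal (f z) w / affineVal (f z) v) (Metric.ball z₁ r) :=
    (analyticOnNhd_affineVal (hf.mono hsubU) w).div (analyticOnNhd_affineVal (hf.mono hsubU) v)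
      fun z hz => (hball hz).2
  have him : ∀ z ∈ Metric.ball z₁ r, (affineVal (f z) w / affineVal (f z) v).im = (0 : ℝ) := by
    intro z hz
    have := hcon z (hball hz).1
    unfold crossVal at this
    rw [Complex.div_im, ← sub_div]
    rw [div_eq_zero_iff]
    left; linarith
  obtain ⟨s, hs⟩ := hg.eq_const_add_im_mul_I_of_re_eq_const him Metric.isOpen_ball
    ((convex_ball z₁ r).isConnected ⟨z₁, Metric.mem_ball_self hr⟩)
  have h0 := eq_zero_of_affineVal_eq_zero hf hU hind Metric.isOpen_ball
    ⟨z₁, Metric.mem_ball_self hr⟩ hsubU (v := w - s • v) (by simp [hv1, hw1]) (by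
      intro z hz
      have h1 := hs z hz
      rw [div_eq_iff (hball hz).2] at h1
      rw [affineVal_sub_smul, h1]
      simp)
  have := congrFun h0 b
  simp [hvb, hwb] at this

/-- Uniform lower bound for nonzero integer vectors. -/
theorem exists_affineVal_lower_bound (hf : AnalyticOnNhd ℂ f U) (hU : IsPreconnected U)
    (hind : IndepWithOne U f) {O : Set ℂ} (hO : IsOpen O) (hOne : O.Nonempty) (hOU : O ⊆ U) :
    ∃ ρ : ℝ, 0 < ρ ∧ ∀ v : Fin 2 ⊕ Fin n → ℝ, v (Sum.inl 1) = 0 → 1 ≤ ‖v‖ →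
      ∃ z ∈ O, ρ ≤ ‖affineVal (f z) v‖ := by
  obtain ⟨ρ, hρ, h⟩ := exists_uniform_lower_bound
    (K := Metric.sphere (0 : Fin 2 ⊕ Fin n → ℝ) 1 ∩ {v | v (Sum.inl 1) = 0}) (B := O)
    (Φ := fun v z => ‖affineVal (f z) v‖)
    ((isCompact_sphere _ _).inter_right (isClosed_eq (continuous_apply _) continuous_const))
    (fun z _ => (continuous_affineVal _).norm) (by
      rintro v ⟨hv, hv1⟩
      by_contra! hcon
      have := eq_zero_of_affineVal_eq_zero hf hU hind hO hOne hOU hv1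
        fun z hz => norm_eq_zero.mp (hcon z hz)
      rw [this] at hv
      simp at hv)
  refine ⟨ρ, hρ, fun v hv1 hv => ?_⟩
  have hv0 : ‖v‖ ≠ 0 := by linarith
  -- Rescaling from the unit sphere back to `v` cannot decrease the value, as `1 ≤ ‖v‖`.
  obtain ⟨z, hz, hzρ⟩ := h (‖v‖⁻¹ • v) ⟨by simp [norm_smul, hv0], by simp [hv1]⟩
  refine ⟨z, hz, hzρ.trans ?_⟩
  rw [affineVal_smul, abs_norm, norm_mul, Complex.norm_real, norm_inv, norm_norm]
  exact mul_le_of_le_one_left (norm_nonneg _) (inv_le_one_of_one_le₀ hv)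

/-- Uniform lower bound for normalized pairs of vectors. -/
theorem exists_crossVal_lower_bound (hf : AnalyticOnNhd ℂ f U) (hU : IsPreconnected U)
    (hind : IndepWithOne U f) {O : Set ℂ} (hO : IsOpen O) (hOne : O.Nonempty) (hOU : O ⊆ U) :
    ∃ ρ : ℝ, 0 < ρ ∧ ∀ v w : Fin 2 ⊕ Fin n → ℝ, v (Sum.inl 1) = 0 → w (Sum.inl 1) = 0 →
      ‖v‖ ≤ 1 → ‖w‖ ≤ 1 → ∀ a b, v a = 1 → v b = 0 → w b = 1 →
      ∃ z ∈ O, ρ ≤ |crossVal (f z) v w| := by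
  -- Linear independence of a pair is not a closed condition. Prescribing entries `1`, `0`, `1` at
  -- two positions is closed and still forces independence, so intersecting with the unit ball gives
  -- a compact set.
  set S : Set ((Fin 2 ⊕ Fin n → ℝ) × (Fin 2 ⊕ Fin n → ℝ)) :=
    ⋃ a, ⋃ b, {p | p.1 (Sum.inl 1) = 0 ∧ p.2 (Sum.inl 1) = 0 ∧ p.1 a = 1 ∧ p.1 b = 0 ∧
      p.2 b = 1} with hS
  have hSc : IsClosed S := by
    refine isClosed_iUnion_of_finite fun a => isClosed_iUnion_of_finite fun b => ?_
    refine (isClosed_eq (by fun_prop) (by fun_prop)).inter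
      ((isClosed_eq (by fun_prop) (by fun_prop)).inter
      ((isClosed_eq (by fun_prop) (by fun_prop)).inter
      ((isClosed_eq (by fun_prop) (by fun_prop)).inter
        (isClosed_eq (by fun_prop) (by fun_prop)))))
  obtain ⟨ρ, hρ, h⟩ := exists_uniform_lower_bound
    (K := Metric.closedBall (0 : (Fin 2 ⊕ Fin n → ℝ) × (Fin 2 ⊕ Fin n → ℝ)) 1 ∩ S) (B := O)
    (Φ := fun p z => crossVal (f z) p.1 p.2)
    ((isCompact_closedBall _ _).inter_right hSc)
    (fun z _ => by
      have h1 : Continuous fun p : (Fin 2 ⊕ Fin n → ℝ) × (Fin 2 ⊕ Fin n → ℝ) =>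
        affineVal (f z) p.1 := (continuous_affineVal _).comp continuous_fst
      have h2 : Continuous fun p : (Fin 2 ⊕ Fin n → ℝ) × (Fin 2 ⊕ Fin n → ℝ) =>
        affineVal (f z) p.2 := (continuous_affineVal _).comp continuous_snd
      unfold crossVal
      fun_prop) (by
      rintro ⟨v, w⟩ ⟨-, hp⟩
      simp only [hS, Set.mem_iUnion] at hp
      obtain ⟨a, b, h1, h2, h3, h4, h5⟩ := hp
      exact exists_crossVal_ne_zero hf hU hind hO hOne hOU h1 h2 h3 h4 h5)
  refine ⟨ρ, hρ, fun v w hv1 hw1 hv hw a b h1 h2 h3 => h (v, w) ⟨?_, ?_⟩⟩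
  · simpa [Prod.norm_def] using ⟨hv, hw⟩
  · simp only [hS, Set.mem_iUnion]
    exact ⟨a, b, hv1, hw1, h1, h2, h3⟩

end

/-! ### Normalized minors and the weight of the flow -/

section

/-- A matrix with independent columns has a nonzero maximal minor. -/
theorem exists_det_submatrix_ne_zero {l : Type*} [Fintype l] {k : ℕ} {V : Matrix l (Fin k) ℝ}
    (hV : LinearIndependent ℝ V.col) : ∃ J : Fin k → l, (V.submatrix J id).det ≠ 0 := by
  have hrank : Module.finrank ℝ (Submodule.span ℝ (Set.range V.row)) = k := by
    rw [← Matrix.rank_eq_finrank_span_row, ← Matrix.rank_transpose,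
      LinearIndependent.rank_matrix (M := V.transpose) hV, Fintype.card_fin]
  have hex := Submodule.exists_fun_fin_finrank_span_eq ℝ (Set.range V.row)
  rw [hrank] at hex
  obtain ⟨g, hg, -, hgi⟩ := hex
  choose J hJ using hg
  refine ⟨J, ?_⟩
  have h1 : LinearIndependent ℝ (V.submatrix J id).row := by
    have : (V.submatrix J id).row = g := by
      ext i j; rw [← hJ i]; rfl
    rwa [this]
  rw [← isUnit_iff_ne_zero, ← Matrix.isUnit_iff_isUnit_det]
  exact Matrix.linearIndependent_rows_iff_isUnit.mp h1

variable {n : ℕ}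

/-- A matrix with at least two independent columns has a nonzero maximal minor, all of whose rows
but two avoid two given rows. -/
theorem exists_det_submatrix_ne_zero_avoiding {l : Type*} [Fintype l] [DecidableEq l] {k : ℕ}
    (hk : 2 ≤ k) {V : Matrix l (Fin k) ℝ} (hV : LinearIndependent ℝ V.col) (a b : l) :
    ∃ (m : ℕ) (e : Fin 2 ⊕ Fin m ≃ Fin k) (σ : Fin 2 ⊕ Fin m → l),
      (∀ j, σ (Sum.inr j) ≠ a ∧ σ (Sum.inr j) ≠ b) ∧ (V.submatrix σ e).det ≠ 0 := by
  obtain ⟨J, hJ⟩ := exists_det_submatrix_ne_zero hV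
  have hJinj : Function.Injective J := by
    intro i i' h
    by_contra hne
    exact hJ (Matrix.det_zero_of_row_eq hne (by ext j; simp [h]))
  set D : Finset (Fin k) := Finset.univ.filter fun j => J j ∈ ({a, b} : Finset l) with hD
  have hDc : D.card ≤ 2 :=
    (Finset.card_le_card_of_injOn J (fun j hj => (Finset.mem_filter.mp hj).2)
      hJinj.injOn).trans Finset.card_le_two
  -- At most two chosen rows equal `a` or `b`. Padding their positions to exactly two puts them all
  -- into the `Fin 2` block.
  obtain ⟨D', hDD', hD'⟩ := Finset.exists_superset_card_eq hDc (by simpa using hk)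
  have hcompl : Fintype.card {j // j ∉ D'} = k - 2 := by
    rw [Fintype.card_subtype_compl, Fintype.card_fin, Fintype.card_coe, hD']
  let e₁ : Fin 2 ≃ {j // j ∈ D'} := (D'.equivFinOfCardEq hD').symm
  let e₂ : Fin (k - 2) ≃ {j // j ∉ D'} := (Fintype.equivFinOfCardEq hcompl).symm
  let e : Fin 2 ⊕ Fin (k - 2) ≃ Fin k :=
    (Equiv.sumCongr e₁ e₂).trans (Equiv.sumCompl fun j => j ∈ D')
  refine ⟨k - 2, e, J ∘ e, fun j => ?_, ?_⟩
  · have h1 : e (Sum.inr j) ∉ D := fun h => (e₂ j).2 (hDD' h)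
    simp only [hD, Finset.mem_filter, Finset.mem_univ, true_and, Finset.mem_insert,
      Finset.mem_singleton, not_or] at h1
    exact h1
  · have : V.submatrix (J ∘ e) e = (V.submatrix J id).submatrix e e := rfl
    rwa [this, Matrix.det_submatrix_equiv_self]

/-- After a change of basis, the two distinguished columns are normalized and have entries bounded
by `1`; the remaining columns are standard on the distinguished rows. -/
theorem exists_normalized {l : Type*} [Fintype l] [DecidableEq l] {k : ℕ}
    (hk : 2 ≤ k) {V : Matrix l (Fin k) ℝ} (hV : LinearIndependent ℝ V.col) (a b : l) :
    ∃ (m : ℕ) (e : Fin 2 ⊕ Fin m ≃ Fin k) (σ : Fin 2 ⊕ Fin m → l)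
      (W : Matrix l (Fin 2 ⊕ Fin m) ℝ),
      (∀ j, σ (Sum.inr j) ≠ a ∧ σ (Sum.inr j) ≠ b) ∧ (V.submatrix σ e).det ≠ 0 ∧
      V.submatrix id e = W * V.submatrix σ e ∧ W.submatrix σ id = 1 ∧
      (∀ i x, |W i (Sum.inl x)| ≤ 1) ∧ ∀ i, V i = 0 → W i = 0 := by
  classical
  obtain ⟨m, e, σ₀, hσ₀, hdet₀⟩ := exists_det_submatrix_ne_zero_avoiding hk hV a b
  -- The largest admissible minor is taken so that the entries of `V * B⁻¹` in the two distinguished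
  -- columns, being quotients of minors by Cramer's rule, are at most `1`.
  obtain ⟨σ, hσ, hmax⟩ := Finset.exists_max_image
    (Finset.univ.filter fun σ : Fin 2 ⊕ Fin m → l =>
      ∀ j, σ (Sum.inr j) ≠ a ∧ σ (Sum.inr j) ≠ b)
    (fun σ => |(V.submatrix σ e).det|) ⟨σ₀, by simpa using hσ₀⟩
  have hσ' : ∀ j, σ (Sum.inr j) ≠ a ∧ σ (Sum.inr j) ≠ b := (Finset.mem_filter.mp hσ).2
  set B := V.submatrix σ e with hB
  have hB0 : 0 < |B.det| :=
    (abs_pos.mpr hdet₀).trans_le (hmax σ₀ (by simpa using hσ₀))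
  have hBu : IsUnit B.det := isUnit_iff_ne_zero.mpr (abs_pos.mp hB0)
  set W := V.submatrix id e * B⁻¹ with hW
  have hWB : V.submatrix id e = W * B := by
    rw [hW, Matrix.mul_assoc, Matrix.nonsing_inv_mul _ hBu, Matrix.mul_one]
  have hWσ : W.submatrix σ id = 1 := by
    have : W.submatrix σ id = B * B⁻¹ := rfl
    rw [this, Matrix.mul_nonsing_inv _ hBu]
  refine ⟨m, e, σ, W, hσ', abs_pos.mp hB0, hWB, hWσ, fun i x => ?_, fun i hi => ?_⟩
  -- Admissibility restricts only the `Sum.inr` positions, so changing a row at `Sum.inl x` keeps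
  -- `σ'` in the competition.
  · set σ' := Function.update σ (Sum.inl x) i with hσ''
    have h1 := hmax σ' (Finset.mem_filter.mpr ⟨Finset.mem_univ _, fun j => by
      simpa [hσ''] using hσ' j⟩)
    have h2 : V.submatrix σ' e = W.submatrix σ' id * B := by
      have : V.submatrix σ' e = (V.submatrix id e).submatrix σ' id := rfl
      rw [this, hWB]; rfl
    have h3 : W.submatrix σ' id = (1 : Matrix _ _ ℝ).updateRow (Sum.inl x) (W i) := by
      rw [← hWσ]
      ext p q
      by_cases hp : p = Sum.inl x
      · subst hp; simp [hσ'']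
      · simp [hσ'', Function.update_of_ne hp, Matrix.updateRow_ne hp]
    have h4 : (W.submatrix σ' id).det = W i (Sum.inl x) := by
      rw [h3, ← Matrix.cramer_transpose_apply, Matrix.transpose_one, Matrix.cramer_one]
      rfl
    change |(V.submatrix σ' e).det| ≤ |B.det| at h1
    rw [h2, Matrix.det_mul, h4, abs_mul] at h1
    exact (mul_le_iff_le_one_left hB0).mp h1
  · ext q
    have hi' : ∀ j, V i j = 0 := fun j => congrFun hi j
    simp [hW, Matrix.mul_apply, hi']

/-- A nonzero minor of an integer matrix has absolute value at least `1`. -/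
theorem one_le_abs_det_intCast {m : Type*} [Fintype m] [DecidableEq m] {Z : Matrix m m ℤ}
    (h : (Z.map (Int.cast : ℤ → ℝ)).det ≠ 0) : 1 ≤ |(Z.map (Int.cast : ℤ → ℝ)).det| := by
  have h1 : (Z.map (Int.cast : ℤ → ℝ)).det = ((Z.det : ℤ) : ℝ) := (Int.cast_det Z).symm
  rw [h1] at h ⊢
  exact_mod_cast Int.one_le_abs (by exact_mod_cast h)

/-- The weight of a minor avoiding the largest `t_i` is at least `1`. -/
theorem one_le_weight (hn : 1 ≤ n) {t : Fin n → ℝ} (ht : ∀ i, 0 ≤ t i) {i₀ : Fin n}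
    (hi₀ : ∀ i, t i ≤ t i₀) {m : ℕ} {τ : Fin m → Fin n} (hτ : Function.Injective τ)
    (hτi₀ : ∀ j, τ j ≠ i₀) :
    1 ≤ Real.exp (topExp t) ^ 2 * ∏ j, Real.exp (-t (τ j)) := by
  rw [← Real.exp_sum, ← Real.exp_nat_mul, ← Real.exp_add, Real.one_le_exp_iff,
    Finset.sum_neg_distrib]
  have h1 : ∑ j, t (τ j) ≤ ∑ i ∈ Finset.univ.erase i₀, t i := by
    rw [← Finset.sum_image (f := t) hτ.injOn]
    refine Finset.sum_le_sum_of_subset_of_nonneg ?_ fun i _ _ => ht i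
    intro i hi
    obtain ⟨j, -, rfl⟩ := Finset.mem_image.mp hi
    exact Finset.mem_erase.mpr ⟨hτi₀ j, Finset.mem_univ _⟩
  have h2 : t i₀ + ∑ i ∈ Finset.univ.erase i₀, t i = ∑ i, t i :=
    Finset.add_sum_erase _ _ (Finset.mem_univ i₀)
  have h3 : ∑ i, t i ≤ n * t i₀ := by
    have := Finset.sum_le_card_nsmul Finset.univ t (t i₀) fun i _ => hi₀ i
    simpa using this
  have hn0 : (0 : ℝ) < n := by exact_mod_cast hn
  -- The total exponent is at least `t i₀ - (∑ i, t i) / n`, and a maximum is at least the average.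
  have h4 : 2 * topExp t = ∑ i, t i - (∑ i, t i) / n := by
    unfold topExp; field_simp
  have h5 : (∑ i, t i) / n ≤ t i₀ := by rw [div_le_iff₀ hn0]; linarith
  push_cast
  linarith

/-- Lower bound for some maximal minor of the flow. -/
theorem exists_minor_flow_ge (hn : 1 ≤ n) {k : ℕ} (hk : 2 ≤ k)
    {Z : Matrix (Fin 2 ⊕ Fin n) (Fin k) ℤ}
    {V : Matrix (Fin 2 ⊕ Fin n) (Fin k) ℝ} (hVZ : V = Z.map (Int.cast : ℤ → ℝ))
    (hV : LinearIndependent ℝ V.col) (hV1 : ∀ j, V (Sum.inl 1) j = 0) {t : Fin n → ℝ}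
    (ht : ∀ i, 0 ≤ t i) :
    ∃ v w : Fin 2 ⊕ Fin n → ℝ, v (Sum.inl 1) = 0 ∧ w (Sum.inl 1) = 0 ∧ ‖v‖ ≤ 1 ∧ ‖w‖ ≤ 1 ∧
      (∃ a b, v a = 1 ∧ v b = 0 ∧ w b = 1) ∧
      ∀ z, crossVal z v w ^ 2 ≤
        ((gMat t * uMat z * V).transpose * (gMat t * uMat z * V)).det := by
  have : Nonempty (Fin n) := ⟨⟨0, hn⟩⟩
  obtain ⟨i₀, hi₀⟩ := Finite.exists_max t
  -- The remaining rows are to avoid the first coordinate and the most contracted one. They also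
  -- avoid `Sum.inl 1`, where `V` vanishes, so all of them are contracted coordinates other than
  -- `i₀`.
  obtain ⟨m, e, σ, W, hσ, hdet, hVW, hWσ, hWle, hW0⟩ :=
    exists_normalized hk hV (Sum.inl 0) (Sum.inr i₀)
  set B := V.submatrix σ e with hB
  have hW1 : ∀ q, W (Sum.inl 1) q = 0 := fun q => congrFun (hW0 _ (funext hV1)) q
  have hWσ' : ∀ p q, W (σ p) q = (1 : Matrix _ _ ℝ) p q := fun p q => by rw [← hWσ]; rfl
  have hσ1 : ∀ p, σ p ≠ Sum.inl 1 := by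
    intro p hp
    have := hWσ' p p
    rw [hp, hW1] at this
    simp at this
  have hσinj : Function.Injective σ := by
    intro p q hpq
    by_contra hne
    have h1 := hWσ' p p
    rw [hpq, hWσ', Matrix.one_apply_ne (Ne.symm hne)] at h1
    simp at h1
  have hσr : ∀ j, ∃ i, σ (Sum.inr j) = Sum.inr i := by
    intro j
    rcases h : σ (Sum.inr j) with x | i
    · fin_cases x
      · exact absurd h (hσ j).1
      · exact absurd h (hσ1 _)
    · exact ⟨i, rfl⟩
  choose τ hτ using hσr
  have hτinj : Function.Injective τ := by
    intro j j' h
    have : σ (Sum.inr j) = σ (Sum.inr j') := by rw [hτ, hτ, h]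
    exact Sum.inr_injective (hσinj this)
  have hτi₀ : ∀ j, τ j ≠ i₀ := by
    intro j h
    apply (hσ j).2
    rw [hτ, h]
  have hBdet : 1 ≤ |B.det| := by
    have : B = (Z.submatrix σ e).map (Int.cast : ℤ → ℝ) := by rw [hB, hVZ]; rfl
    rw [this] at hdet ⊢
    exact one_le_abs_det_intCast hdet
  refine ⟨fun a => W a (Sum.inl 0), fun a => W a (Sum.inl 1), hW1 _, hW1 _,
    (pi_norm_le_iff_of_nonneg zero_le_one).mpr fun a => hWle a 0,
    (pi_norm_le_iff_of_nonneg zero_le_one).mpr fun a => hWle a 1,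
    ⟨σ (Sum.inl 0), σ (Sum.inl 1), by simp [hWσ'], by simp [hWσ'], by simp [hWσ']⟩, fun z => ?_⟩
  set A := gMat t * uMat z with hA
  -- This minor keeps the rows `σ (Sum.inr j)` but replaces the two distinguished ones by the first
  -- two coordinates. As `W` is standard on the kept rows, it is block triangular, and its
  -- determinant is `crossVal` times the weight.
  set ψ : Fin 2 ⊕ Fin m → Fin 2 ⊕ Fin n := Sum.elim Sum.inl (fun j => Sum.inr (τ j)) with hψ
  have hψinj : Function.Injective ψ := by
    rintro (x | j) (x' | j') h
    · simpa [hψ] using h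
    · simp [hψ] at h
    · simp [hψ] at h
    · simpa [hψ] using hτinj (by simpa [hψ] using h)
  have hgram : ((A * V).transpose * (A * V)).det =
      ((A * V.submatrix id e).transpose * (A * V.submatrix id e)).det := by
    rw [← Matrix.det_submatrix_equiv_self e]
    rfl
  rw [hgram]
  refine le_trans ?_ (sq_det_submatrix_le_det_gram (A * V.submatrix id e) hψinj)
  have hsub : (A * V.submatrix id e).submatrix ψ id = (A * W).submatrix ψ id * B := by
    rw [hVW, ← Matrix.mul_assoc]; rfl
  set E := Real.exp (topExp t) with hE
  have hblock : (A * W).submatrix ψ id = Matrix.fromBlocks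
      (Matrix.of ![fun x => E * (affineVal z fun a => W a (Sum.inl x)).re,
        fun x => E * (affineVal z fun a => W a (Sum.inl x)).im])
      (Matrix.of ![fun x => E * (affineVal z fun a => W a (Sum.inr x)).re,
        fun x => E * (affineVal z fun a => W a (Sum.inr x)).im])
      0 (Matrix.diagonal fun j => Real.exp (-t (τ j))) := by
    ext p q
    rcases p with x | j
    · fin_cases x
      · rcases q with q | q <;> simp [hψ, hA, flow_mul_inl_zero, hE]
      · rcases q with q | q <;> simp [hψ, hA, flow_mul_inl_one, hE, hW1]
    · have h1 := hWσ' (Sum.inr j) q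
      rw [hτ] at h1
      rcases q with q | q
      · simp [hψ, hA, flow_mul_inr, h1]
      · simp [hψ, hA, flow_mul_inr, h1, Matrix.one_apply, Matrix.diagonal_apply]
  rw [hsub, Matrix.det_mul, hblock, Matrix.det_fromBlocks_zero₂₁, Matrix.det_diagonal,
    Matrix.det_fin_two]
  simp only [Matrix.of_apply, Matrix.cons_val_zero, Matrix.cons_val_one]
  have hweight := one_le_weight hn ht hi₀ hτinj hτi₀
  set X := crossVal z (fun a => W a (Sum.inl 0)) (fun a => W a (Sum.inl 1)) with hX
  have hfac : (E * (affineVal z fun a => W a (Sum.inl 0)).re *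
      (E * (affineVal z fun a => W a (Sum.inl 1)).im) -
      E * (affineVal z fun a => W a (Sum.inl 1)).re *
      (E * (affineVal z fun a => W a (Sum.inl 0)).im)) * (∏ j, Real.exp (-t (τ j))) * B.det =
      (E ^ 2 * ∏ j, Real.exp (-t (τ j))) * B.det * X := by
    rw [hX, crossVal]; ring
  rw [hfac, sq_le_sq, abs_mul, abs_mul]
  refine le_mul_of_one_le_left (abs_nonneg _) ?_
  exact one_le_mul_of_one_le_of_one_le (hweight.trans (le_abs_self _)) hBdet

/-! ### Lower bound for all ranks and the conclusion -/

/-- The lower bound for the supremum of the covolume functions over a ball. -/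
theorem exists_flowCovol_lower_bound (hn : 1 ≤ n) {U : Set ℂ} {f : ℂ → Fin n → ℂ}
    (hf : AnalyticOnNhd ℂ f U) (hU : IsPreconnected U) (hind : IndepWithOne U f) {O : Set ℂ}
    (hO : IsOpen O) (hOne : O.Nonempty) (hOU : O ⊆ U) :
    ∃ ρ : ℝ, 0 < ρ ∧ ∀ t : Fin n → ℝ, (∀ i, 0 ≤ t i) →
      ∀ Γ : AddSubgroup (Space n), Γ ≤ Lam n → Γ ≠ ⊥ →
        ∃ z ∈ O, ρ ≤ flowCovol t (f z) Γ := by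
  obtain ⟨ρ₁, hρ₁, h₁⟩ := exists_affineVal_lower_bound hf hU hind hO hOne hOU
  obtain ⟨ρ₂, hρ₂, h₂⟩ := exists_crossVal_lower_bound hf hU hind hO hOne hOU
  refine ⟨min ρ₁ ρ₂, lt_min hρ₁ hρ₂, fun t ht Γ hΓ hΓ0 => ?_⟩
  obtain ⟨k, V, hk, -, hVi, hV1, ⟨Z, hVZ⟩, hcov⟩ := exists_matrix_flowCovol_sq hΓ hΓ0
  rcases hk.eq_or_lt with rfl | hk2
  -- In rank one there is no second column for `crossVal`; the Gram determinant is a sum of squares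
  -- whose first two terms already give `exp (topExp t) ^ 2 * ‖affineVal (f z) v‖ ^ 2`.
  · set v : Fin 2 ⊕ Fin n → ℝ := fun a => V a 0 with hv
    have hvnorm : 1 ≤ ‖v‖ := by
      have hv0 : v ≠ 0 := hVi.ne_zero 0
      obtain ⟨a, ha⟩ := Function.ne_iff.mp hv0
      have : v a = ((Z a 0 : ℤ) : ℝ) := by rw [hv, hVZ]; rfl
      refine le_trans ?_ (norm_le_pi_norm v a)
      have hZ : Z a 0 ≠ 0 := fun h0 => ha (by rw [this, h0]; simp)
      rw [this, Real.norm_eq_abs]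
      exact_mod_cast Int.one_le_abs hZ
    obtain ⟨z, hz, hzρ⟩ := h₁ v (hV1 0) hvnorm
    refine ⟨z, hz, (min_le_left _ _).trans (hzρ.trans ?_)⟩
    refine (sq_le_sq₀ (norm_nonneg _) (flowCovol_nonneg _ _ _)).mp ?_
    have hE : 1 ≤ Real.exp (topExp t) := by
      rw [Real.one_le_exp_iff, topExp]
      have : (1 : ℝ) ≤ n := by exact_mod_cast hn
      exact mul_nonneg (div_nonneg (by linarith) (by linarith))
        (Finset.sum_nonneg fun i _ => ht i)
    rw [hcov, Matrix.det_fin_one, Matrix.mul_apply, Fintype.sum_sum_type, Fin.sum_univ_two]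
    simp only [Matrix.transpose_apply]
    rw [flow_mul_inl_zero, flow_mul_inl_one _ _ _ _ (hV1 0), ← Complex.normSq_eq_norm_sq,
      Complex.normSq_apply]
    have h3 : 0 ≤ ∑ i : Fin n, (gMat t * uMat (f z) * V) (Sum.inr i) 0 *
        (gMat t * uMat (f z) * V) (Sum.inr i) 0 :=
      Finset.sum_nonneg fun i _ => mul_self_nonneg _
    have h4 : 1 ≤ Real.exp (topExp t) * Real.exp (topExp t) :=
      one_le_mul_of_one_le_of_one_le hE hE
    nlinarith [mul_self_nonneg (affineVal (f z) v).re, mul_self_nonneg (affineVal (f z) v).im]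
  · obtain ⟨v, w, hv1, hw1, hv, hw, ⟨a, b, hva, hvb, hwb⟩, hle⟩ :=
      exists_minor_flow_ge hn hk2 hVZ hVi hV1 ht
    obtain ⟨z, hz, hzρ⟩ := h₂ v w hv1 hw1 hv hw a b hva hvb hwb
    refine ⟨z, hz, (min_le_right _ _).trans (hzρ.trans ?_)⟩
    refine (sq_le_sq₀ (abs_nonneg _) (flowCovol_nonneg _ _ _)).mp ?_
    rw [sq_abs, hcov]
    exact hle (f z)

end

end CovolumeGood

theorem lemma3p1 (n : ℕ) (hn : 1 ≤ n) (U : Set ℂ) (hU : IsOpen U)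
    (f : ℂ → Fin n → ℂ) (hf : AnalyticOnNhd ℂ f U) :
    (∀ z₀ ∈ U, ∃ r : ℝ, 0 < r ∧ Metric.ball z₀ r ⊆ U ∧
      ∃ C α : ℝ, 0 < C ∧ 0 < α ∧
        ∀ t : Fin n → ℝ, (∀ i, 0 ≤ t i) →
        ∀ Γ : AddSubgroup (CovolumeGood.Space n), Γ ≤ CovolumeGood.Lam n → Γ ≠ ⊥ →
          CovolumeGood.IsGood C α (fun z => CovolumeGood.flowCovol t (f z) Γ)
            (Metric.ball z₀ r)) ∧
    (IsPreconnected U → CovolumeGood.IndepWithOne U f →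
      ∀ (c : ℂ) (r : ℝ), 0 < r → Metric.ball c r ⊆ U →
        ∃ ρ : ℝ, 0 < ρ ∧
          ∀ t : Fin n → ℝ, (∀ i, 0 ≤ t i) →
          ∀ Γ : AddSubgroup (CovolumeGood.Space n), Γ ≤ CovolumeGood.Lam n → Γ ≠ ⊥ →
            ENNReal.ofReal ρ ≤
              ⨆ z ∈ Metric.ball c r,
                ENNReal.ofReal (CovolumeGood.flowCovol t (f z) Γ)) := by
  constructor
  · intro z₀ hz₀
    obtain ⟨r, hr, hrU, C, α, hC, hα, h⟩ := CovolumeGood.exists_isGood_flowCovol hU hf hz₀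
    exact ⟨r, hr, hrU, C, α, hC, hα, fun t _ Γ hΓ hΓ0 => h t Γ hΓ hΓ0⟩
  · intro hUc hind c r hr hrU
    obtain ⟨ρ, hρ, h⟩ := CovolumeGood.exists_flowCovol_lower_bound hn hf hUc hind
      Metric.isOpen_ball ⟨c, Metric.mem_ball_self hr⟩ hrU
    refine ⟨ρ, hρ, fun t ht Γ hΓ hΓ0 => ?_⟩
    obtain ⟨z, hz, hzρ⟩ := h t ht Γ hΓ hΓ0
    exact (ENNReal.ofReal_le_ofReal hzρ).trans
      (le_iSup₂ (f := fun z _ => ENNReal.ofReal (CovolumeGood.flowCovol t (f z) Γ)) z hz)
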